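/- Let $\Omega\subset\mathbb{C}$ be an open set. Let $\overline\partial u=u_{\bar z}=\tfrac12(u_x+iu_y)$ act on $L^2(\Omega)$ in the sense of distributions, with domain $\operatorname{Dom}(\overline\partial)=\{u\in L^2(\Omega):\overline\partial u\in L^2(\Omega)\}$, and let $A^2(\Omega)\subset L^2(\Omega)$ be the subspace of square-integrable holomorphic functions on $\Omega$. The best closed-range constant $\mathfrak{C}(\Omega)\in[0,\infty]$ is the infimum of all $C\in[0,\infty)$ such that $$\|u\|_{L^2(\Omega)}\le C\,\|\overline\partial u\|_{L^2(\Omega)}\qquad\text{for all }u\in\operatorname{Dom}(\overline\partial)\cap A^2(\Omega)^{\perp},$$ with $\mathfrak{C}(\Omega)=\infty$ if there is no such $C$. A set $E\subset\mathbb{C}$ is called polar if every non-trivial finite Borel measure $\mu$ with compact support in $E$ has energy $\int_{\mathbb{C}}\int_{\mathbb{C}}\ln|z-w|\,d\mu(w)\,d\mu(z)=-\infty$. Then the following hold. (a) If $\Omega'$ is obtained from $\Omega$ by translation, rotation, reflection, or a combination thereof (that is, $\Omega'=T(\Omega)$ for an isometry $T$ of the plane $\mathbb{C}$), then $\mathfrak{C}(\Omega')=\mathfrak{C}(\Omega)$.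 (b) For every $r>0$ and $r\Omega=\{rz:z\in\Omega\}$, one has $\mathfrak{C}(r\Omega)=r\,\mathfrak{C}(\Omega)$ (with $r\cdot\infty=\infty$). (c) If $\Omega'\subset\Omega$ is open and $\Omega\setminus\Omega'$ is polar, then $\mathfrak{C}(\Omega')=\mathfrak{C}(\Omega)$. -/

import Mathlib

open MeasureTheory
open scoped ENNReal NNReal ContDiff

noncomputable section

namespace DbarPlane

/-- `L²(Ω)` with respect to planar Lebesgue measure. -/
abbrev L2 (Ω : Set ℂ) : Type := Lp ℂ 2 (volume.restrict Ω)

/-- The Wirtinger derivative `φ_{z̄} = (φ_x + i φ_y) / 2`. -/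
def wirtingerBar (φ : ℂ → ℂ) (z : ℂ) : ℂ :=
  (1 / 2 : ℂ) * (fderiv ℝ φ z 1 + Complex.I * fderiv ℝ φ z Complex.I)

/-- `φ ∈ C_c^∞(Ω)`: a smooth function whose closed support is a compact subset of `Ω`. -/
def IsTestFunction (Ω : Set ℂ) (φ : ℂ → ℂ) : Prop :=
  ContDiff ℝ ∞ φ ∧ HasCompactSupport φ ∧ tsupport φ ⊆ Ω

/-- `u` belongs to the domain of the maximal `∂̄`-operator on `L²(Ω)` and `∂̄ u = f`: the
functions `u, f` are in `L²(Ω)` and `∂̄ u = f` on `Ω` in the sense of distributions. -/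
def IsDbar (Ω : Set ℂ) (u f : L2 Ω) : Prop :=
  ∀ φ : ℂ → ℂ, IsTestFunction Ω φ →
    ∫ z in Ω, u z * wirtingerBar φ z = - ∫ z in Ω, f z * φ z

/-- The Bergman space `A²(Ω)` of square-integrable holomorphic functions on `Ω`, as a subspace
of `L²(Ω)`. -/
def bergman (Ω : Set ℂ) : Submodule ℂ (L2 Ω) where
  carrier := {h | ∃ g : ℂ → ℂ, DifferentiableOn ℂ g Ω ∧ h =ᵐ[volume.restrict Ω] g}
  add_mem' := by
    rintro a b ⟨g, hg, hag⟩ ⟨k, hk, hbk⟩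
    exact ⟨g + k, hg.add hk, (Lp.coeFn_add a b).trans (hag.add hbk)⟩
  zero_mem' := ⟨0, differentiableOn_const 0, Lp.coeFn_zero ℂ 2 _⟩
  smul_mem' := by
    rintro c a ⟨g, hg, hag⟩
    exact ⟨c • g, hg.const_smul c, (Lp.coeFn_smul c a).trans (hag.const_smul c)⟩

/-- `∂̄` has closed range in `L²(Ω)` with constant `C`: `‖u‖ ≤ C ‖∂̄ u‖` for all
`u ∈ Dom(∂̄) ∩ A²(Ω)^⊥`. -/
def HasClosedRangeWith (Ω : Set ℂ) (C : ℝ≥0) : Prop :=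
  ∀ u f : L2 Ω, IsDbar Ω u f → u ∈ (bergman Ω)ᗮ → ‖u‖ ≤ C * ‖f‖

/-- The best closed-range constant `ℭ(Ω) ∈ [0, ∞]`: the infimum of all constants `C` with which
`∂̄` has closed range in `L²(Ω)`. It is `∞` if there is no such (finite) `C`. -/
def closedRangeConst (Ω : Set ℂ) : ℝ≥0∞ :=
  ⨅ (C : ℝ≥0) (_ : HasClosedRangeWith Ω C), (C : ℝ≥0∞)

/-- The integral of an extended-real function, as the integral of the positive part minus the
integral of the negative part. It is only used below for functions whose positive part has
finite integral, and may then take the value `-∞`. -/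
def erealIntegral (μ : Measure ℂ) (f : ℂ → EReal) : EReal :=
  ((∫⁻ w, (f w).toENNReal ∂μ : ℝ≥0∞) : EReal) - ((∫⁻ w, (-f w).toENNReal ∂μ : ℝ≥0∞) : EReal)

/-- The logarithmic potential `p_μ(z) = ∫ ln |z - w| dμ(w)`, with `ln 0 = -∞`. -/
def logPotential (μ : Measure ℂ) (z : ℂ) : EReal :=
  erealIntegral μ fun w => ENNReal.log ‖z - w‖ₑ

/-- The logarithmic energy `I_μ = ∫ p_μ(z) dμ(z)`. -/
def logEnergy (μ : Measure ℂ) : EReal :=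
  erealIntegral μ (logPotential μ)

/-- A set `E ⊆ ℂ` is polar if every non-trivial finite Borel measure with compact support
contained in `E` has energy `-∞`. -/
def IsPolar (E : Set ℂ) : Prop :=
  ∀ μ : Measure ℂ, IsFiniteMeasure μ → μ ≠ 0 → IsCompact μ.support → μ.support ⊆ E →
    logEnergy μ = ⊥

end DbarPlane

end

/-! For (a) and (b), let `T` be an affine map `z ↦ a z + b` or complex conjugation, and let `J` be
the identity or conjugation accordingly. The pullback `g ↦ J ∘ g ∘ T` intertwines `∂̄` up to a
constant factor of modulus `|a|` (or `1`), maps holomorphic functions to holomorphic functions and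
multiplies all `L²` norms by the same constant. The estimate therefore passes to `T '' Ω` with its
constant multiplied by that modulus (`HasClosedRangeWith.image`), and the inverse map gives
equality. By Mazur–Ulam these maps generate all isometries.

For (c), a polar difference is Lebesgue null, so both sets have the same `L²` space. It remains to
see that `∂̄` and the Bergman space are also the same, which is removability
(`WeakDbar.of_diff_polar`): a test function `φ` on `Ω` is multiplied by `1 - ψ n`, where `ψ n = 1`
near the compact polar set `K = tsupport φ \ Ω'` and `∇ψ n → 0` in `L²`. The error `∫ u φ ∂̄(ψ n)`
tends to zero by Cauchy–Schwarz. With `f = 0` and Weyl's lemma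
(`exists_holomorphic_of_weakDbar_zero`), square-integrable holomorphic functions extend across the
difference.

The cutoffs exist because polarity forces zero capacity. For regularized logarithmic kernels on `K`,
the minimal energy `V` tends to infinity: otherwise compactness would give one measure with bounded
regularized energies, hence of finite logarithmic energy. The equilibrium potential is at least `V`
on `K`, stays bounded away from `K`, and has Dirichlet integral `O(V)`. Truncating its quotient by
`V` leaves a Dirichlet integral `O(1/V)` (`exists_cutoffs`). -/

namespace DbarPlane

open Complex Set

/-! ### The Cauchy–Pompeiu formula -/

/-- The unit vector of argument `θ`, in the form in which it occurs in polar coordinates. -/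
noncomputable def unitVec (θ : ℝ) : ℂ := Real.cos θ + Real.sin θ * I

lemma unitVec_eq_exp (θ : ℝ) : unitVec θ = exp (θ * I) := by
  rw [unitVec, exp_mul_I]; simp

lemma unitVec_ne_zero (θ : ℝ) : unitVec θ ≠ 0 := by
  rw [unitVec_eq_exp]; exact exp_ne_zero _

lemma norm_unitVec (θ : ℝ) : ‖unitVec θ‖ = 1 := by
  rw [unitVec_eq_exp, norm_exp_ofReal_mul_I]

@[fun_prop]
lemma continuous_unitVec : Continuous unitVec := by
  unfold unitVec; fun_prop

lemma hasDerivAt_unitVec (θ : ℝ) : HasDerivAt unitVec (I * unitVec θ) θ := by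
  have h : HasDerivAt (fun t : ℝ => exp ((t : ℂ) * I)) (exp (θ * I) * (1 * I)) θ :=
    ((ofRealCLM.hasDerivAt (x := θ)).mul_const I).cexp
  rw [funext unitVec_eq_exp]
  simpa [mul_comm] using h

/-- The map `v ↦ L v + I * L (I * v)` is conjugate-linear over `ℂ`, and the conjugate of a unit
vector is its inverse. This expresses `∂̄` through radial and angular derivatives. -/
lemma wirtingerBar_mul_inv_unitVec (L : ℂ →L[ℝ] ℂ) (θ : ℝ) :
    (L 1 + I * L I) / unitVec θ = L (unitVec θ) + I * L (I * unitVec θ) := by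
  have h1 : unitVec θ = Real.cos θ • (1 : ℂ) + Real.sin θ • I := by
    simp [unitVec]
  have h2 : I * unitVec θ = (-Real.sin θ) • (1 : ℂ) + Real.cos θ • I := by
    simp only [unitVec, real_smul]; push_cast; ring_nf; rw [I_sq]; ring
  rw [div_eq_iff (unitVec_ne_zero θ), h2, h1]
  simp only [map_add, map_smul]
  simp only [real_smul]
  have h3 : (Real.sin θ : ℂ) ^ 2 + (Real.cos θ : ℂ) ^ 2 = 1 := by
    exact_mod_cast Real.sin_sq_add_cos_sq θ
  push_cast at *
  linear_combination (-(L 1) - I * L I) * h3 + (L 1 * sin θ ^ 2 - L I * sin θ * cos θ) * I_sq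

lemma integrableOn_polar_of_continuous {F : ℝ × ℝ → ℂ} (hF : Continuous F) {R : ℝ}
    (h0 : ∀ p : ℝ × ℝ, R < p.1 → F p = 0) :
    IntegrableOn F (Ioi 0 ×ˢ Ioo (-Real.pi) Real.pi) := by
  have h1 : IntegrableOn F (Icc 0 R ×ˢ Icc (-Real.pi) Real.pi) :=
    hF.continuousOn.integrableOn_compact (isCompact_Icc.prod isCompact_Icc)
  refine (h1.of_forall_sdiff_eq_zero (t := Ici 0 ×ˢ Icc (-Real.pi) Real.pi)
    (measurableSet_Ici.prod measurableSet_Icc) ?_).mono_set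
      (prod_mono Ioi_subset_Ici_self Ioo_subset_Icc_self)
  rintro ⟨r, θ⟩ ⟨⟨hr, hθ⟩, h⟩
  refine h0 _ ?_
  by_contra hc
  exact h ⟨⟨hr, not_lt.1 hc⟩, hθ⟩

/-- The Cauchy–Pompeiu formula at the origin for compactly supported functions. -/
lemma integral_wirtingerBar_div {ψ : ℂ → ℂ} (hψ : ContDiff ℝ 1 ψ) (hc : HasCompactSupport ψ) :
    ∫ w, wirtingerBar ψ w / w = - (Real.pi * ψ 0) := by
  have hd : Continuous (fderiv ℝ ψ) := hψ.continuous_fderiv one_ne_zero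
  obtain ⟨R, hR0, hR⟩ := (hc.fderiv ℝ).isCompact.isBounded.exists_pos_norm_lt
  obtain ⟨R', hR0', hR'⟩ := hc.isCompact.isBounded.exists_pos_norm_lt
  have hz : ∀ z : ℂ, R ≤ ‖z‖ → fderiv ℝ ψ z = 0 := fun z hz => by
    by_contra h
    exact absurd (hR z (subset_tsupport _ h)) (not_lt.2 hz)
  have hz' : ∀ z : ℂ, R' ≤ ‖z‖ → ψ z = 0 := fun z hz => by
    by_contra h
    exact absurd (hR' z (subset_tsupport _ h)) (not_lt.2 hz)
  set A : ℝ × ℝ → ℂ := fun p => fderiv ℝ ψ (p.1 * unitVec p.2) (unitVec p.2) with hA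
  set B : ℝ × ℝ → ℂ := fun p => fderiv ℝ ψ (p.1 * unitVec p.2) (I * unitVec p.2) with hB
  have hnorm : ∀ p : ℝ × ℝ, R < p.1 → R ≤ ‖(p.1 : ℂ) * unitVec p.2‖ := fun p hp => by
    rw [norm_mul, norm_unitVec, mul_one, norm_real]
    exact hp.le.trans (le_abs_self _)
  have hcd : Continuous fun p : ℝ × ℝ => fderiv ℝ ψ (p.1 * unitVec p.2) :=
    hd.comp (by fun_prop)
  have hAc : Continuous A := hcd.clm_apply (by fun_prop)
  have hBc : Continuous B := hcd.clm_apply (by fun_prop)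
  have hA0 : ∀ p : ℝ × ℝ, R < p.1 → A p = 0 := fun p hp => by simp [hA, hz _ (hnorm p hp)]
  have hAi : IntegrableOn A (Ioi 0 ×ˢ Ioo (-Real.pi) Real.pi) :=
    integrableOn_polar_of_continuous hAc hA0
  have hBi : IntegrableOn B (Ioi 0 ×ˢ Ioo (-Real.pi) Real.pi) :=
    integrableOn_polar_of_continuous hBc (R := R) fun p hp => by
      simp [hB, hz _ (hnorm p hp)]
  have hdr : ∀ θ r : ℝ, HasDerivAt (fun r : ℝ => ψ (r * unitVec θ)) (A (r, θ)) r := by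
    intro θ r
    have h1 : HasDerivAt (fun r : ℝ => (r : ℂ) * unitVec θ) (1 * unitVec θ) r :=
      (ofRealCLM.hasDerivAt (x := r)).mul_const _
    rw [one_mul] at h1
    exact ((hψ.differentiable one_ne_zero).differentiableAt.hasFDerivAt).comp_hasDerivAt r h1
  have hdθ : ∀ r θ : ℝ, HasDerivAt (fun θ : ℝ => ψ (r * unitVec θ)) (r * B (r, θ)) θ := by
    intro r θ
    have h1 : HasDerivAt (fun θ : ℝ => (r : ℂ) * unitVec θ) (r * (I * unitVec θ)) θ :=
      (hasDerivAt_unitVec θ).const_mul _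
    have := ((hψ.differentiable one_ne_zero).differentiableAt.hasFDerivAt).comp_hasDerivAt θ h1
    rw [← real_smul (x := r) (z := I * unitVec θ), map_smul, real_smul] at this
    exact this
  -- `A` is the radial derivative of `ψ`, so each ray contributes `-ψ 0`.
  have hAint : ∫ p in Ioi (0 : ℝ) ×ˢ Ioo (-Real.pi) Real.pi, A p = -(2 * Real.pi * ψ 0) := by
    rw [Measure.volume_eq_prod, ← Measure.prod_restrict, integral_prod_symm]
    · have : ∀ θ, ∫ r in Ioi (0 : ℝ), A (r, θ) = - ψ 0 := by
        intro θ
        have hev : ∀ᶠ r : ℝ in Filter.atTop, ψ (r * unitVec θ) = 0 := by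
          filter_upwards [Filter.eventually_ge_atTop R'] with r hr
          refine hz' _ ?_
          rw [norm_mul, norm_unitVec, mul_one, norm_real]
          exact hr.trans (le_abs_self _)
        have hAr : IntegrableOn (fun r => A (r, θ)) (Ioi 0) := by
          refine ((hAc.comp (Continuous.prodMk_left θ)).continuousOn.integrableOn_compact
              (isCompact_Icc (a := (0 : ℝ)) (b := R))).of_forall_sdiff_eq_zero
                measurableSet_Ioi ?_
          rintro r ⟨hr, h⟩
          have : R < r := by
            by_contra hc
            exact h ⟨le_of_lt hr, not_lt.1 hc⟩
          exact hA0 (r, θ) this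
        have := integral_Ioi_of_hasDerivAt_of_tendsto
          (hdr θ 0).continuousAt.continuousWithinAt (fun r _ => hdr θ r) hAr
          (tendsto_const_nhds.congr' (hev.mono fun _ h => h.symm))
        simpa using this
      simp only [this]
      simp [Real.pi_pos.le]
      ring_nf
      simp
    · rw [Measure.prod_restrict]; exact hAi
  have hBint : ∫ p in Ioi (0 : ℝ) ×ˢ Ioo (-Real.pi) Real.pi, B p = 0 := by
    rw [Measure.volume_eq_prod, setIntegral_prod _ hBi]
    refine (setIntegral_congr_fun measurableSet_Ioi fun r hr => ?_).trans (integral_zero ℝ ℂ)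
    have hr0 : (r : ℂ) ≠ 0 := by exact_mod_cast (ne_of_gt hr)
    -- `r * B` is the angular derivative of `ψ`, whose integral over a full circle vanishes by
    -- periodicity.
    have h1 : ∫ θ in (-Real.pi)..Real.pi, (r : ℂ) * B (r, θ) = 0 := by
      rw [intervalIntegral.integral_eq_sub_of_hasDerivAt (fun θ _ => hdθ r θ)]
      · have : unitVec Real.pi = unitVec (-Real.pi) := by simp [unitVec]
        rw [this, sub_self]
      · refine Continuous.intervalIntegrable ?_ _ _
        exact continuous_const.mul (hBc.comp (Continuous.prodMk_right r))
    rw [intervalIntegral.integral_const_mul, mul_eq_zero, or_iff_right hr0,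
      intervalIntegral.integral_of_le (by linarith [Real.pi_pos]),
      integral_Ioc_eq_integral_Ioo] at h1
    exact h1
  rw [← Complex.integral_comp_polarCoord_symm]
  -- The Jacobian `r` cancels the modulus of `1 / w`.
  have : ∀ p ∈ polarCoord.target, p.1 • (wirtingerBar ψ (Complex.polarCoord.symm p) /
      Complex.polarCoord.symm p) = (1 / 2 : ℂ) * (A p + I * B p) := by
    rintro ⟨r, θ⟩ ⟨hr, -⟩
    have hr0 : (r : ℂ) ≠ 0 := by exact_mod_cast (ne_of_gt hr)
    rw [Complex.polarCoord_symm_apply, wirtingerBar, real_smul]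
    simp only [hA, hB]
    rw [← wirtingerBar_mul_inv_unitVec]
    change (r : ℂ) * (1 / 2 * _ / (r * unitVec θ)) = _
    field_simp [unitVec_ne_zero]
    rfl
  rw [setIntegral_congr_fun polarCoord.open_target.measurableSet this, integral_const_mul,
    polarCoord_target, integral_add hAi (hBi.const_mul I), integral_const_mul, hAint, hBint]
  ring

lemma wirtingerBar_comp_sub {φ : ℂ → ℂ} (hφ : Differentiable ℝ φ) (z w : ℂ) :
    wirtingerBar (fun v => φ (z - v)) w = - wirtingerBar φ (z - w) := by
  have : fderiv ℝ (fun v => φ (z - v)) w = - fderiv ℝ φ (z - w) := by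
    have h := (hφ (z - w)).hasFDerivAt.comp w ((hasFDerivAt_id w).const_sub z)
    exact h.fderiv.trans (by ext; simp)
  simp only [wirtingerBar, this, neg_apply]
  ring

/-- The Cauchy–Pompeiu formula for compactly supported functions. -/
lemma integral_wirtingerBar_sub_div {φ : ℂ → ℂ} (hφ : ContDiff ℝ 1 φ) (hc : HasCompactSupport φ)
    (z : ℂ) : ∫ w, wirtingerBar φ (z - w) / w = Real.pi * φ z := by
  have h := integral_wirtingerBar_div (ψ := fun v => φ (z - v))
    (hφ.comp (contDiff_const.sub contDiff_id)) (hc.comp_homeomorph (Homeomorph.subLeft z))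
  simp only [wirtingerBar_comp_sub (hφ.differentiable one_ne_zero), neg_div, sub_zero] at h
  rw [integral_neg] at h
  exact neg_injective h

end DbarPlane

/-! ### The weak `∂̄`-equation and the Cauchy transform -/

namespace DbarPlane

open Complex Set Metric Filter Topology

/-- `∂̄ u = f` on `Ω` in the sense of distributions, for functions `u` and `f`. -/
def WeakDbar (Ω : Set ℂ) (u f : ℂ → ℂ) : Prop :=
  ∀ φ : ℂ → ℂ, IsTestFunction Ω φ →
    ∫ z in Ω, u z * wirtingerBar φ z = - ∫ z in Ω, f z * φ z

lemma wirtingerBar_mul {φ ψ : ℂ → ℂ} {z : ℂ} (hφ : DifferentiableAt ℝ φ z)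
    (hψ : DifferentiableAt ℝ ψ z) :
    wirtingerBar (fun w => φ w * ψ w) z = φ z * wirtingerBar ψ z + wirtingerBar φ z * ψ z := by
  have : fderiv ℝ (fun w => φ w * ψ w) z = φ z • fderiv ℝ ψ z + ψ z • fderiv ℝ φ z :=
    fderiv_fun_mul hφ hψ
  simp only [wirtingerBar, this, add_apply, smul_apply, smul_eq_mul]
  ring

lemma norm_wirtingerBar_le (φ : ℂ → ℂ) (z : ℂ) : ‖wirtingerBar φ z‖ ≤ ‖fderiv ℝ φ z‖ := by
  have h1 : ‖fderiv ℝ φ z 1‖ ≤ ‖fderiv ℝ φ z‖ := by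
    simpa using (fderiv ℝ φ z).le_opNorm 1
  have h2 : ‖fderiv ℝ φ z I‖ ≤ ‖fderiv ℝ φ z‖ := by
    simpa using (fderiv ℝ φ z).le_opNorm I
  have h3 := norm_add_le (fderiv ℝ φ z 1) (I * fderiv ℝ φ z I)
  rw [wirtingerBar, norm_mul]
  rw [norm_mul, norm_I, one_mul] at h3
  norm_num
  linarith

lemma continuous_wirtingerBar {φ : ℂ → ℂ} (hφ : ContDiff ℝ 1 φ) : Continuous (wirtingerBar φ) := by
  have := hφ.continuous_fderiv one_ne_zero
  unfold wirtingerBar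
  fun_prop

lemma wirtingerBar_eq_zero_of_fderiv {φ : ℂ → ℂ} {z : ℂ} (h : fderiv ℝ φ z = 0) :
    wirtingerBar φ z = 0 := by
  simp [wirtingerBar, h]

lemma support_wirtingerBar_subset (φ : ℂ → ℂ) : Function.support (wirtingerBar φ) ⊆ tsupport φ :=
  fun _ hz => support_fderiv_subset ℝ fun h => hz (wirtingerBar_eq_zero_of_fderiv h)

lemma tsupport_wirtingerBar_subset (φ : ℂ → ℂ) : tsupport (wirtingerBar φ) ⊆ tsupport φ :=
  closure_minimal (support_wirtingerBar_subset φ) (isClosed_tsupport φ)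

lemma hasCompactSupport_wirtingerBar {φ : ℂ → ℂ} (h : HasCompactSupport φ) :
    HasCompactSupport (wirtingerBar φ) :=
  h.of_isClosed_subset (isClosed_tsupport _) (tsupport_wirtingerBar_subset φ)

lemma IsTestFunction.contDiff_one {Ω : Set ℂ} {φ : ℂ → ℂ} (h : IsTestFunction Ω φ) :
    ContDiff ℝ 1 φ := h.1.of_le (by exact_mod_cast le_top)

lemma IsTestFunction.differentiable {Ω : Set ℂ} {φ : ℂ → ℂ} (h : IsTestFunction Ω φ) :
    Differentiable ℝ φ := h.contDiff_one.differentiable one_ne_zero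

lemma IsTestFunction.mono {Ω Ω' : Set ℂ} {φ : ℂ → ℂ} (h : IsTestFunction Ω φ) (hs : Ω ⊆ Ω') :
    IsTestFunction Ω' φ := ⟨h.1, h.2.1, h.2.2.trans hs⟩

lemma integrable_mul_of_tsupport_subset {Ω : Set ℂ} {u ψ : ℂ → ℂ} (hu : LocallyIntegrableOn u Ω)
    (hψ : Continuous ψ) (hc : HasCompactSupport ψ) (hs : tsupport ψ ⊆ Ω) :
    Integrable fun z => u z * ψ z := by
  rw [← integrableOn_iff_integrable_of_support_subset (s := tsupport ψ)]
  · exact (hu.integrableOn_compact_subset hs hc.isCompact).mul_continuousOn hψ.continuousOn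
      hc.isCompact
  · intro z hz
    exact subset_tsupport _ (right_ne_zero_of_mul hz)

lemma setIntegral_mul_eq_of_tsupport_subset {Ω : Set ℂ} (u : ℂ → ℂ) {ψ : ℂ → ℂ}
    (hs : tsupport ψ ⊆ Ω) : ∫ z in Ω, u z * ψ z = ∫ z, u z * ψ z := by
  refine setIntegral_eq_integral_of_forall_compl_eq_zero fun z hz => ?_
  rw [image_eq_zero_of_notMem_tsupport (fun h => hz (hs h)), mul_zero]

/-- Integration by parts in a real direction `v` moves the derivative onto `g`, where it is `v *
deriv g`. The directions `1` and `I` then enter with weights `1` and `I * I = -1` and cancel. -/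
lemma weakDbar_zero_of_differentiableOn {Ω : Set ℂ} (hΩ : IsOpen Ω) {g : ℂ → ℂ}
    (hg : DifferentiableOn ℂ g Ω) : WeakDbar Ω g 0 := by
  intro φ hφ
  have hφ1 := hφ.contDiff_one
  rw [setIntegral_mul_eq_of_tsupport_subset _ ((tsupport_wirtingerBar_subset φ).trans hφ.2.2)]
  have hgl : LocallyIntegrableOn g Ω := hg.continuousOn.locallyIntegrableOn hΩ.measurableSet
  have hgl' : LocallyIntegrableOn (deriv g) Ω :=
    (hg.deriv hΩ).continuousOn.locallyIntegrableOn hΩ.measurableSet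
  have hd : ∀ z ∈ Ω, ∀ v, fderiv ℝ g z v = v * deriv g z := fun z hz v => by
    have h := (hg.differentiableAt (hΩ.mem_nhds hz))
    rw [(h.hasFDerivAt.restrictScalars ℝ).fderiv]
    simp
  have hfd : Continuous (fderiv ℝ φ) := hφ1.continuous_fderiv one_ne_zero
  have hI0 : Integrable fun z => deriv g z * φ z :=
    integrable_mul_of_tsupport_subset hgl' hφ1.continuous hφ.2.1 hφ.2.2
  have hfe : ∀ v : ℂ, (fun z => fderiv ℝ g z v * φ z) = fun z => v * (deriv g z * φ z) := by
    intro v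
    ext z
    by_cases hz : z ∈ tsupport φ
    · rw [hd z (hφ.2.2 hz), mul_assoc]
    · simp [image_eq_zero_of_notMem_tsupport hz]
  have hI1 : ∀ v : ℂ, Integrable fun z => g z * fderiv ℝ φ z v := fun v => by
    have hss : tsupport (fun z => fderiv ℝ φ z v) ⊆ tsupport φ := tsupport_fderiv_apply_subset ℝ v
    exact integrable_mul_of_tsupport_subset hgl (by fun_prop)
      (hφ.2.1.of_isClosed_subset (isClosed_tsupport _) hss) (hss.trans hφ.2.2)
  have key : ∀ v : ℂ, ∫ z, g z * fderiv ℝ φ z v = - (v * ∫ z, deriv g z * φ z) := by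
    intro v
    rw [integral_mul_fderiv_eq_neg_fderiv_mul_of_integrable]
    · rw [hfe v, integral_const_mul]
    · rw [hfe v]; exact hI0.const_mul v
    · exact hI1 v
    · exact integrable_mul_of_tsupport_subset hgl hφ1.continuous hφ.2.1 hφ.2.2
    · exact fun z hz => (hg.differentiableAt (hΩ.mem_nhds (hφ.2.2 hz))).restrictScalars ℝ
    · exact fun z _ => hφ.differentiable z
  have : ∀ z, g z * wirtingerBar φ z
      = (1 / 2 : ℂ) * (g z * fderiv ℝ φ z 1 + I * (g z * fderiv ℝ φ z I)) := fun z => by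
    rw [wirtingerBar]; ring
  simp only [this]
  rw [integral_const_mul, integral_add (hI1 1) ((hI1 I).const_mul I), integral_const_mul,
    key, key]
  simp [← mul_assoc]

/-- The Cauchy transform `φ * (1 / π z)`. -/
noncomputable def cauchyTransform (φ : ℂ → ℂ) : ℂ → ℂ :=
  convolution (fun w : ℂ => (Real.pi * w : ℂ)⁻¹) φ (ContinuousLinearMap.mul ℝ ℂ) volume

lemma locallyIntegrable_inv_pi_mul : LocallyIntegrable fun w : ℂ => (Real.pi * w : ℂ)⁻¹ := by
  refine locallyIntegrable_of_norm_le_rpow (C := Real.pi⁻¹) (α := 1) (by simp)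
    (by simp) (Eventually.of_forall fun w => ?_) (by fun_prop)
  rw [Real.rpow_neg_one, norm_inv, norm_mul, norm_real, Real.norm_of_nonneg Real.pi_pos.le, mul_inv]

lemma contDiff_cauchyTransform {φ : ℂ → ℂ} (hφ : ContDiff ℝ ∞ φ) (hc : HasCompactSupport φ) :
    ContDiff ℝ ∞ (cauchyTransform φ) :=
  hc.contDiff_convolution_right (n := ⊤) _ locallyIntegrable_inv_pi_mul hφ

lemma cauchyTransform_apply (φ : ℂ → ℂ) (w : ℂ) :
    cauchyTransform φ w = ∫ z, (Real.pi * (w - z) : ℂ)⁻¹ * φ z := by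
  rw [cauchyTransform, convolution_def]
  simp only [ContinuousLinearMap.mul_apply']
  rw [← integral_sub_left_eq_self (fun z => (Real.pi * z : ℂ)⁻¹ * φ (w - z)) volume w]
  simp

/-- The derivative of the convolution falls on `φ`, which leaves exactly the Cauchy–Pompeiu
integral. -/
lemma wirtingerBar_cauchyTransform {φ : ℂ → ℂ} (hφ : ContDiff ℝ 1 φ) (hc : HasCompactSupport φ)
    (z : ℂ) : wirtingerBar (cauchyTransform φ) z = φ z := by
  have h := (hc.hasFDerivAt_convolution_right (μ := volume) (ContinuousLinearMap.mul ℝ ℂ)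
    locallyIntegrable_inv_pi_mul hφ z).fderiv
  have hfd := hφ.continuous_fderiv one_ne_zero
  have hv : ∀ v : ℂ, fderiv ℝ (cauchyTransform φ) z v
      = ∫ w, (Real.pi * w : ℂ)⁻¹ * fderiv ℝ φ (z - w) v := fun v => by
    rw [cauchyTransform, h, convolution_precompR_apply _ locallyIntegrable_inv_pi_mul
      (hc.fderiv ℝ) hfd, convolution_def]
    rfl
  have hi : ∀ v : ℂ, Integrable fun w => (Real.pi * w : ℂ)⁻¹ * fderiv ℝ φ (z - w) v := fun v => by
    have h1 : HasCompactSupport fun w => fderiv ℝ φ w v :=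
      hc.of_isClosed_subset (isClosed_tsupport _) (tsupport_fderiv_apply_subset ℝ v)
    have h2 : HasCompactSupport fun w => fderiv ℝ φ (z - w) v :=
      h1.comp_homeomorph (Homeomorph.subLeft z)
    exact integrable_mul_of_tsupport_subset (Ω := univ)
      (locallyIntegrableOn_univ.2 locallyIntegrable_inv_pi_mul) (by fun_prop) h2 (subset_univ _)
  have hp : (Real.pi : ℂ) ≠ 0 := by exact_mod_cast Real.pi_ne_zero
  have := integral_wirtingerBar_sub_div hφ hc z
  rw [wirtingerBar, hv, hv, ← integral_const_mul I, ← integral_add (hi 1) ((hi I).const_mul I),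
    ← integral_const_mul, ← mul_right_inj' hp, ← this, ← integral_const_mul]
  congr 1 with w
  rw [wirtingerBar, mul_inv]
  field_simp

end DbarPlane

/-! ### Weyl's lemma for `∂̄` -/

namespace DbarPlane

open Complex Set Metric Filter Topology

/-- Differentiation under the integral sign for the Cauchy transform of a function, off the support
of the function. -/
lemma differentiableOn_cauchyTransform {f : ℂ → ℂ} (hf : Integrable f) {z₀ : ℂ} {r : ℝ}
    (hr : 0 < r) (h0 : ∀ w ∈ ball z₀ (2 * r), f w = 0) :
    DifferentiableOn ℂ (fun z => ∫ w, f w * (Real.pi * (z - w) : ℂ)⁻¹) (ball z₀ r) := by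
  intro z hz
  have hp : (Real.pi : ℂ) ≠ 0 := by exact_mod_cast Real.pi_ne_zero
  -- The gap `r` between the ball and the support of `f` bounds the kernel by `1 / (π r)` and its
  -- derivative by `1 / (π r ^ 2)`.
  have hne : ∀ w, f w ≠ 0 → ∀ x ∈ ball z₀ r, r ≤ ‖x - w‖ := by
    intro w hw x hx
    have h1 : 2 * r ≤ dist w z₀ := by
      by_contra hc
      exact hw (h0 w (mem_ball.2 (not_le.1 hc)))
    have h2 := dist_triangle w x z₀
    rw [mem_ball] at hx
    rw [← dist_eq_norm, dist_comm]
    linarith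
  refine (hasDerivAt_integral_of_dominated_loc_of_deriv_le (μ := volume) (𝕜 := ℂ)
    (F := fun z w => f w * (Real.pi * (z - w) : ℂ)⁻¹)
    (F' := fun z w => f w * (-Real.pi / (Real.pi * (z - w) : ℂ) ^ 2))
    (bound := fun w => ‖f w‖ * (Real.pi * r ^ 2)⁻¹)
    (isOpen_ball.mem_nhds hz) ?_ ?_ ?_ ?_ ?_ ?_).2.differentiableAt.differentiableWithinAt
  · exact Eventually.of_forall fun x =>
      hf.aestronglyMeasurable.mul (by fun_prop)
  · refine Integrable.mono' (hf.norm.mul_const (Real.pi * r)⁻¹)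
      (hf.aestronglyMeasurable.mul (by fun_prop)) (Eventually.of_forall fun w => ?_)
    by_cases hw : f w = 0
    · simp [hw]
    · have := hne w hw z hz
      rw [norm_mul, norm_inv, norm_mul, norm_real, Real.norm_of_nonneg Real.pi_pos.le]
      have := Real.pi_pos
      gcongr
  · exact hf.aestronglyMeasurable.mul (by
      refine Measurable.aestronglyMeasurable ?_
      fun_prop)
  · refine Eventually.of_forall fun w x hx => ?_
    by_cases hw : f w = 0
    · simp [hw]
    · have := hne w hw x hx
      have hpi := Real.pi_pos
      have hpos := hr.trans_le this
      rw [norm_mul, norm_div, norm_neg, norm_pow, norm_mul, norm_real,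
        Real.norm_of_nonneg Real.pi_pos.le]
      refine mul_le_mul_of_nonneg_left ?_ (norm_nonneg _)
      rw [mul_pow, inv_eq_one_div, div_le_div_iff₀ (by positivity) (by positivity)]
      have : r ^ 2 ≤ ‖x - w‖ ^ 2 := by gcongr
      nlinarith [mul_pos hpi hpi]
  · exact hf.norm.mul_const _
  · refine Eventually.of_forall fun w x hx => ?_
    by_cases hw : f w = 0
    · simpa [hw] using hasDerivAt_const x (0 : ℂ)
    · have hxw : x - w ≠ 0 := by
        have := hne w hw x hx
        exact norm_pos_iff.1 (hr.trans_le this)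
      have h1 : HasDerivAt (fun x => (Real.pi * (x - w) : ℂ)) (Real.pi * 1) x :=
        ((hasDerivAt_id x).sub_const w).const_mul _
      have h2 := (h1.inv (mul_ne_zero hp hxw)).const_mul (f w)
      rwa [mul_one] at h2

lemma contDiff_ofReal_bump {z₀ : ℂ} (χ : ContDiffBump z₀) :
    ContDiff ℝ ∞ fun z => (χ z : ℂ) := ofRealCLM.contDiff.comp χ.contDiff

lemma tsupport_ofReal_bump {z₀ : ℂ} (χ : ContDiffBump z₀) :
    tsupport (fun z => (χ z : ℂ)) = closedBall z₀ χ.rOut := by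
  rw [← χ.tsupport_eq]
  unfold tsupport
  congr 1
  ext z
  simp

/-- Weyl's lemma for `∂̄` on a disc. -/
lemma exists_holomorphic_of_weakDbar_zero_ball {Ω : Set ℂ} {u : ℂ → ℂ}
    (hu : LocallyIntegrableOn u Ω) (h : WeakDbar Ω u 0) {z₀ : ℂ} {r : ℝ} (hr : 0 < r)
    (hs : closedBall z₀ (3 * r) ⊆ Ω) :
    ∃ g : ℂ → ℂ, DifferentiableOn ℂ g (ball z₀ r) ∧ ∀ᵐ z, z ∈ ball z₀ r → u z = g z := by
  let χ : ContDiffBump z₀ := ⟨2 * r, 3 * r, by linarith, by linarith⟩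
  set X : ℂ → ℂ := fun z => (χ z : ℂ) with hX
  have hXc : ContDiff ℝ ∞ X := contDiff_ofReal_bump χ
  have hX1 : ContDiff ℝ 1 X := hXc.of_le (by exact_mod_cast le_top)
  have hXs : tsupport X = closedBall z₀ (3 * r) := tsupport_ofReal_bump χ
  have hXk : HasCompactSupport X := by
    rw [HasCompactSupport, hXs]; exact isCompact_closedBall _ _
  have hXe : ∀ z ∈ closedBall z₀ (2 * r), X z = 1 := fun z hz => by
    simp [hX, χ.one_of_mem_closedBall hz]
  -- Since `X` is constant on the ball of radius `2 * r`, `f` vanishes there, and its Cauchy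
  -- transform `g` is holomorphic on the ball of radius `r`.
  set f : ℂ → ℂ := fun w => u w * wirtingerBar X w with hf
  have hfi : Integrable f := integrable_mul_of_tsupport_subset hu (continuous_wirtingerBar hX1)
    (hasCompactSupport_wirtingerBar hXk)
    ((tsupport_wirtingerBar_subset X).trans (hXs.subset.trans hs))
  have hf0 : ∀ w ∈ ball z₀ (2 * r), f w = 0 := by
    intro w hw
    have : X =ᶠ[𝓝 w] fun _ => 1 := by
      filter_upwards [isOpen_ball.mem_nhds hw] with z hz using hXe z (ball_subset_closedBall hz)
    have h2 : fderiv ℝ X w = 0 := by rw [this.fderiv_eq]; simp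
    simp [hf, wirtingerBar_eq_zero_of_fderiv h2]
  set g : ℂ → ℂ := fun z => ∫ w, f w * (Real.pi * (z - w) : ℂ)⁻¹ with hg
  have hgd : DifferentiableOn ℂ g (ball z₀ r) := differentiableOn_cauchyTransform hfi hr hf0
  refine ⟨g, hgd, ?_⟩
  have hbΩ : ball z₀ r ⊆ Ω := (ball_subset_closedBall.trans
    (closedBall_subset_closedBall (by linarith))).trans hs
  have hul : LocallyIntegrableOn u (ball z₀ r) := hu.mono_set hbΩ
  have hgl : LocallyIntegrableOn g (ball z₀ r) :=
    hgd.continuousOn.locallyIntegrableOn measurableSet_ball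
  -- The equation is tested on `X` times the Cauchy transform `Φ` of `φ`. As `∂̄Φ = φ` and `X = 1`
  -- where `φ ≠ 0`, this gives `∫ u φ = -∫ f Φ`; Fubini and the antisymmetry of the Cauchy kernel
  -- turn the right side into `∫ g φ`.
  have key : ∀ φ : ℂ → ℂ, IsTestFunction (ball z₀ r) φ → ∫ z, u z * φ z = ∫ z, g z * φ z := by
    intro φ hφ
    have hΦ : ContDiff ℝ ∞ (cauchyTransform φ) := contDiff_cauchyTransform hφ.1 hφ.2.1
    have hΦ1 : ContDiff ℝ 1 (cauchyTransform φ) := hΦ.of_le (by exact_mod_cast le_top)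
    have hts : tsupport (fun z => X z * cauchyTransform φ z) ⊆ tsupport X :=
      closure_mono fun z hz => left_ne_zero_of_mul hz
    have htest : IsTestFunction Ω fun z => X z * cauchyTransform φ z :=
      ⟨hXc.mul hΦ, hXk.of_isClosed_subset (isClosed_tsupport _) hts,
        hts.trans (hXs.subset.trans hs)⟩
    have h1 := h _ htest
    rw [setIntegral_mul_eq_of_tsupport_subset _
      ((tsupport_wirtingerBar_subset _).trans htest.2.2)] at h1
    have h2 : ∀ z, u z * wirtingerBar (fun z => X z * cauchyTransform φ z) z
        = u z * φ z + f z * cauchyTransform φ z := by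
      intro z
      rw [wirtingerBar_mul (hX1.differentiable one_ne_zero z) (hΦ1.differentiable one_ne_zero z),
        wirtingerBar_cauchyTransform hφ.contDiff_one hφ.2.1, hf]
      by_cases hz : z ∈ ball z₀ r
      · rw [hXe z (closedBall_subset_closedBall (by linarith) (ball_subset_closedBall hz))]
        ring
      · have : φ z = 0 := image_eq_zero_of_notMem_tsupport fun h => hz (hφ.2.2 h)
        rw [this]; ring
    simp only [h2] at h1
    have hi1 : Integrable fun z => u z * φ z :=
      integrable_mul_of_tsupport_subset hul hφ.1.continuous hφ.2.1 hφ.2.2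
    have hi2 : Integrable fun z => f z * cauchyTransform φ z := by
      have : (fun z => f z * cauchyTransform φ z)
          = fun z => u z * (wirtingerBar X z * cauchyTransform φ z) := by
        ext z; rw [hf]; ring
      rw [this]
      have hts : tsupport (fun z => wirtingerBar X z * cauchyTransform φ z) ⊆ tsupport X :=
        (closure_mono fun z hz => left_ne_zero_of_mul hz).trans (tsupport_wirtingerBar_subset X)
      exact integrable_mul_of_tsupport_subset hu ((continuous_wirtingerBar hX1).mul hΦ.continuous)
        (hXk.of_isClosed_subset (isClosed_tsupport _) hts) (hts.trans (hXs.subset.trans hs))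
    rw [integral_add hi1 hi2] at h1
    simp only [Pi.zero_apply, zero_mul, integral_zero, neg_zero] at h1
    have hφi : Integrable φ := hφ.1.continuous.integrable_of_hasCompactSupport hφ.2.1
    have hprod : Integrable (Function.uncurry fun w z : ℂ =>
        f w * (φ z * (Real.pi * (w - z) : ℂ)⁻¹)) (volume.prod volume) := by
      have hm : AEStronglyMeasurable (fun p : ℂ × ℂ => f p.1 * φ p.2 * (Real.pi * (p.1 - p.2) : ℂ)⁻¹)
          (volume.prod volume) :=
        (hfi.mul_prod hφi).aestronglyMeasurable.mul (by fun_prop)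
      refine Integrable.mono' ((hfi.mul_prod hφi).norm.mul_const (Real.pi * r)⁻¹)
        (hm.congr (Eventually.of_forall fun p => by simp [Function.uncurry, mul_assoc]))
        (Eventually.of_forall fun ⟨w, z⟩ => ?_)
      simp only [Function.uncurry]
      by_cases hw : f w = 0
      · simp [hw]
      by_cases hz : φ z = 0
      · simp [hz]
      have h1 : 2 * r ≤ dist w z₀ := by
        by_contra hc
        exact hw (hf0 w (mem_ball.2 (not_le.1 hc)))
      have h2 : dist z z₀ < r := hφ.2.2 (subset_tsupport _ hz)
      have h3 := dist_triangle w z z₀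
      have h4 : r ≤ ‖w - z‖ := by rw [← dist_eq_norm]; linarith
      rw [← mul_assoc, norm_mul, norm_inv, norm_mul (Real.pi : ℂ), norm_real,
        Real.norm_of_nonneg Real.pi_pos.le]
      have := Real.pi_pos
      gcongr
    have h5 : ∫ z, f z * cauchyTransform φ z = - ∫ z, g z * φ z := by
      calc ∫ z, f z * cauchyTransform φ z
          = ∫ w, ∫ z, f w * (φ z * (Real.pi * (w - z) : ℂ)⁻¹) := by
            congr 1 with w
            rw [cauchyTransform_apply, ← integral_const_mul]
            congr 1 with z
            ring
        _ = ∫ z, ∫ w, f w * (φ z * (Real.pi * (w - z) : ℂ)⁻¹) := integral_integral_swap hprod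
        _ = - ∫ z, g z * φ z := by
            rw [← integral_neg]
            congr 1 with z
            rw [hg, ← neg_mul, ← integral_neg, ← integral_mul_const]
            congr 1 with w
            rw [← neg_sub z w, mul_neg, inv_neg]
            ring
    rw [h5] at h1
    linear_combination h1
  have := isOpen_ball.ae_eq_zero_of_integral_contDiff_smul_eq_zero (hul.sub hgl) (μ := volume)
    fun ψ hψ hψc hψs => ?_
  · filter_upwards [this] with z hz hzb
    exact sub_eq_zero.1 (hz hzb)
  · have hts : tsupport (fun z => (ψ z : ℂ)) = tsupport ψ := by
      unfold tsupport; congr 1; ext; simp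
    have ht : IsTestFunction (ball z₀ r) fun z => (ψ z : ℂ) :=
      ⟨ofRealCLM.contDiff.comp hψ, by rw [HasCompactSupport, hts]; exact hψc, by rwa [hts]⟩
    have hi : ∀ v : ℂ → ℂ, LocallyIntegrableOn v (ball z₀ r) → Integrable fun z => v z * (ψ z : ℂ) :=
      fun v hv => integrable_mul_of_tsupport_subset hv ht.1.continuous ht.2.1 ht.2.2
    have : ∀ z, ψ z • (u - g) z = u z * (ψ z : ℂ) - g z * (ψ z : ℂ) := fun z => by
      simp; ring
    simp only [this]
    rw [integral_sub (hi u hul) (hi g hgl), key _ ht, sub_self]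

/-- Weyl's lemma for `∂̄`. -/
theorem exists_holomorphic_of_weakDbar_zero {Ω : Set ℂ} (hΩ : IsOpen Ω) {u : ℂ → ℂ}
    (hu : LocallyIntegrableOn u Ω) (h : WeakDbar Ω u 0) :
    ∃ g : ℂ → ℂ, DifferentiableOn ℂ g Ω ∧ u =ᵐ[volume.restrict Ω] g := by
  have hloc : ∀ z₀ : ℂ, ∃ r > 0, ∃ g : ℂ → ℂ, z₀ ∈ Ω →
      (DifferentiableOn ℂ g (ball z₀ r) ∧ ∀ᵐ z, z ∈ ball z₀ r → u z = g z) := by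
    intro z₀
    by_cases hz : z₀ ∈ Ω
    · obtain ⟨ε, hε, hb⟩ := nhds_basis_closedBall.mem_iff.1 (hΩ.mem_nhds hz)
      obtain ⟨g, hg⟩ := exists_holomorphic_of_weakDbar_zero_ball hu h (r := ε / 3) (z₀ := z₀)
        (by positivity) (by rwa [mul_div_cancel₀ _ (by norm_num)])
      exact ⟨ε / 3, by positivity, g, fun _ => hg⟩
    · exact ⟨1, one_pos, 0, fun h => absurd h hz⟩
  choose r hr G hG using hloc
  -- Local representatives agree almost everywhere on overlaps, hence everywhere by continuity, so
  -- the diagonal `z ↦ G z z` is locally one of them.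
  have heq : ∀ z₀ ∈ Ω, ∀ z ∈ ball z₀ (r z₀), z ∈ Ω → G z z = G z₀ z := by
    intro z₀ hz₀ z hz hzΩ
    have ho : IsOpen (ball z₀ (r z₀) ∩ ball z (r z)) := isOpen_ball.inter isOpen_ball
    have hae : G z =ᵐ[volume.restrict (ball z₀ (r z₀) ∩ ball z (r z))] G z₀ := by
      filter_upwards [ae_restrict_of_ae (hG z₀ hz₀).2, ae_restrict_of_ae (hG z hzΩ).2,
        ae_restrict_mem ho.measurableSet] with w h1 h2 h3
      rw [← h1 h3.1, h2 h3.2]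
    exact Measure.eqOn_open_of_ae_eq hae ho
      ((hG z hzΩ).1.continuousOn.mono inter_subset_right)
      ((hG z₀ hz₀).1.continuousOn.mono inter_subset_left) ⟨hz, mem_ball_self (hr z)⟩
  have hev : ∀ z₀ ∈ Ω, ∀ᶠ z in 𝓝 z₀, z ∈ ball z₀ (r z₀) ∧ z ∈ Ω := fun z₀ hz₀ =>
    (isOpen_ball.eventually_mem (mem_ball_self (hr z₀))).and (hΩ.mem_nhds hz₀)
  refine ⟨fun z => G z z, fun z₀ hz₀ => ?_, ?_⟩
  · have h1 : DifferentiableAt ℂ (G z₀) z₀ :=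
      (hG z₀ hz₀).1.differentiableAt (isOpen_ball.mem_nhds (mem_ball_self (hr z₀)))
    refine (h1.congr_of_eventuallyEq ?_).differentiableWithinAt
    filter_upwards [hev z₀ hz₀] with z hz using heq z₀ hz₀ z hz.1 hz.2
  · rw [EventuallyEq, ae_restrict_iff' hΩ.measurableSet, ae_iff]
    refine measure_null_of_locally_null _ fun z₀ hz₀ => ?_
    simp only [Classical.not_imp, mem_ofPred_eq] at hz₀
    refine ⟨{z | ¬ (z ∈ ball z₀ (r z₀) → u z = G z₀ z)}, ?_, ae_iff.1 (hG z₀ hz₀.1).2⟩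
    filter_upwards [self_mem_nhdsWithin, mem_nhdsWithin_of_mem_nhds (hev z₀ hz₀.1)] with z h1 h2
    simp only [Classical.not_imp] at h1 ⊢
    exact ⟨h2.1, fun h => h1.2 (h.trans (heq z₀ hz₀.1 z h2.1 h2.2).symm)⟩

end DbarPlane

/-! ### The estimate for functions and its transport -/

namespace DbarPlane

open Complex Set Metric Filter Topology ComplexConjugate

/-- The closed range estimate in terms of functions in place of elements of `Lp`. -/
lemma hasClosedRangeWith_iff {Ω : Set ℂ} {C : ℝ≥0} :
    HasClosedRangeWith Ω C ↔ ∀ u f : ℂ → ℂ, MemLp u 2 (volume.restrict Ω) →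
      MemLp f 2 (volume.restrict Ω) → WeakDbar Ω u f →
      (∀ g : ℂ → ℂ, DifferentiableOn ℂ g Ω → MemLp g 2 (volume.restrict Ω) →
        ∫ z in Ω, u z * conj (g z) = 0) →
      eLpNorm u 2 (volume.restrict Ω) ≤ C * eLpNorm f 2 (volume.restrict Ω) := by
  constructor
  · intro h u f hu hf hd ho
    have h1 := h (hu.toLp u) (hf.toLp f) ?_ ?_
    · rw [Lp.norm_toLp, Lp.norm_toLp] at h1
      rw [← ENNReal.ofReal_toReal hu.eLpNorm_ne_top, ← ENNReal.ofReal_toReal hf.eLpNorm_ne_top,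
        ← ENNReal.ofReal_coe_nnreal, ← ENNReal.ofReal_mul C.coe_nonneg]
      exact ENNReal.ofReal_le_ofReal h1
    · intro φ hφ
      have h2 : ∫ z in Ω, hu.toLp u z * wirtingerBar φ z = ∫ z in Ω, u z * wirtingerBar φ z :=
        integral_congr_ae (by filter_upwards [hu.coeFn_toLp] with z hz; rw [hz])
      have h3 : ∫ z in Ω, hf.toLp f z * φ z = ∫ z in Ω, f z * φ z :=
        integral_congr_ae (by filter_upwards [hf.coeFn_toLp] with z hz; rw [hz])
      rw [h2, h3]
      exact hd φ hφ
    · rw [Submodule.mem_orthogonal]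
      rintro v ⟨g, hg, hvg⟩
      rw [L2.inner_def, ← ho g hg ((memLp_congr_ae hvg).1 (Lp.memLp v))]
      refine integral_congr_ae ?_
      filter_upwards [hvg, hu.coeFn_toLp] with z h1 h2
      rw [h1, h2]
      rfl
  · intro h u f hd ho
    have h1 := h u f (Lp.memLp u) (Lp.memLp f) hd fun g hg hgm => ?_
    · rw [Lp.norm_def, Lp.norm_def, ← ENNReal.coe_toReal, ← ENNReal.toReal_mul]
      exact ENNReal.toReal_mono (ENNReal.mul_ne_top ENNReal.coe_ne_top (Lp.memLp f).eLpNorm_ne_top)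
        h1
    · rw [Submodule.mem_orthogonal] at ho
      rw [← ho (hgm.toLp g) ⟨g, hg, hgm.coeFn_toLp⟩, L2.inner_def]
      refine integral_congr_ae ?_
      filter_upwards [hgm.coeFn_toLp] with z h1
      rw [h1]
      rfl

section Transport

variable {T : ℂ ≃ₜ ℂ} {k : ℝ≥0∞}

lemma map_restrict_of_map_eq_smul (hk : Measure.map T volume = k • volume) (Ω : Set ℂ) :
    Measure.map T (volume.restrict Ω) = k • volume.restrict (T '' Ω) := by
  rw [← Measure.restrict_smul, ← hk, T.measurableEmbedding.restrict_map,
    T.injective.preimage_image]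

lemma setIntegral_comp_eq (hk : Measure.map T volume = k • volume) (Ω : Set ℂ) (F : ℂ → ℂ) :
    ∫ z in Ω, F (T z) = k.toReal • ∫ z in T '' Ω, F z := by
  rw [← T.measurableEmbedding.integral_map, map_restrict_of_map_eq_smul hk, integral_smul_measure]

lemma eLpNorm_comp_eq (hk : Measure.map T volume = k • volume) (Ω : Set ℂ) (F : ℂ → ℂ) :
    eLpNorm (fun z => F (T z)) 2 (volume.restrict Ω)
      = k ^ (1 / 2 : ℝ) * eLpNorm F 2 (volume.restrict (T '' Ω)) := by
  have h := T.measurableEmbedding.eLpNorm_map_measure (g := F) (p := 2) (μ := volume.restrict Ω)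
  rw [map_restrict_of_map_eq_smul hk, eLpNorm_smul_measure_of_ne_top (by simp)] at h
  rw [show (fun z => F (T z)) = F ∘ T from rfl, ← h]
  simp

lemma memLp_comp_iff (hk : Measure.map T volume = k • volume) (h0 : k ≠ 0) (ht : k ≠ ⊤)
    (Ω : Set ℂ) (F : ℂ → ℂ) :
    MemLp (fun z => F (T z)) 2 (volume.restrict Ω) ↔ MemLp F 2 (volume.restrict (T '' Ω)) := by
  rw [show (fun z => F (T z)) = F ∘ T from rfl, ← T.measurableEmbedding.memLp_map_measure_iff,
    map_restrict_of_map_eq_smul hk]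
  refine ⟨fun h => ?_, fun h => h.smul_measure ht⟩
  have := h.smul_measure (c := k⁻¹) (by simpa using h0)
  rwa [smul_smul, ENNReal.inv_mul_cancel h0 ht, one_smul] at this

/-- Transport of the closed range estimate along a homeomorphism `T` of the plane such that
`g ↦ J ∘ g ∘ T` is compatible with `∂̄`. -/
lemma HasClosedRangeWith.image (hk : Measure.map T volume = k • volume) (h0 : k ≠ 0) (ht : k ≠ ⊤)
    {J : ℂ ≃ₗᵢ[ℝ] ℂ} (hJmul : ∀ z w, J (z * w) = J z * J w) (hJJ : ∀ z, J (J z) = z)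
    (hJc : ∀ z, J (conj z) = conj (J z)) {β : ℂ}
    (hsmooth : ContDiff ℝ ∞ T.symm)
    (hbar : ∀ φ : ℂ → ℂ, Differentiable ℝ φ → ∀ z,
      β * J (wirtingerBar (fun w => J (φ (T.symm w))) (T z)) = wirtingerBar φ z)
    {Ω : Set ℂ} (hhol : ∀ g : ℂ → ℂ, DifferentiableOn ℂ g Ω →
      DifferentiableOn ℂ (fun w => J (g (T.symm w))) (T '' Ω))
    {C : ℝ≥0} (h : HasClosedRangeWith Ω C) :
    HasClosedRangeWith (T '' Ω) (‖β‖₊ * C) := by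
  have hint : ∀ F : ℂ → ℂ, ∫ z in Ω, J (F (T z)) = k.toReal • J (∫ z in T '' Ω, F z) := by
    intro F
    rw [← map_smul, ← setIntegral_comp_eq hk Ω F]
    exact J.toContinuousLinearEquiv.integral_comp_comm _
  have hJn : ∀ F : ℂ → ℂ, eLpNorm (fun z => J (F (T z))) 2 (volume.restrict Ω)
      = k ^ (1 / 2 : ℝ) * eLpNorm F 2 (volume.restrict (T '' Ω)) := fun F => by
    rw [← eLpNorm_comp_eq hk]
    exact eLpNorm_congr_norm_ae (Eventually.of_forall fun z => J.norm_map _)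
  have hJm : ∀ (F : ℂ → ℂ), MemLp F 2 (volume.restrict (T '' Ω)) →
      MemLp (fun z => J (F (T z))) 2 (volume.restrict Ω) := fun F hF =>
    (J.toContinuousLinearEquiv.toContinuousLinearMap).comp_memLp' ((memLp_comp_iff hk h0 ht Ω F).2 hF)
  rw [hasClosedRangeWith_iff] at h ⊢
  intro u f hu hf hd ho
  -- The pair is pulled back to `Ω`; the factor `β` corrects the derivative of the pullback.
  have h1 := h (fun z => J (u (T z))) (fun z => β * J (f (T z))) (hJm u hu)
    ((hJm f hf).const_mul β) ?_ ?_
  · have h2 : eLpNorm (fun z => β * J (f (T z))) 2 (volume.restrict Ω)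
        = ‖β‖ₑ * eLpNorm (fun z => J (f (T z))) 2 (volume.restrict Ω) :=
      eLpNorm_const_smul β _ _ _
    rw [h2, hJn, hJn, show (C : ℝ≥0∞) * (‖β‖ₑ * (k ^ (1 / 2 : ℝ) *
      eLpNorm f 2 (volume.restrict (T '' Ω)))) = k ^ (1 / 2 : ℝ) * (‖β‖ₑ * C *
      eLpNorm f 2 (volume.restrict (T '' Ω))) by ring] at h1
    -- The volume factor `k ^ (1 / 2)` is finite, nonzero and the same on both sides.
    rw [ENNReal.mul_le_mul_iff_right (by simp [h0, ht]) (by simp [h0, ht])] at h1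
    exact h1
  · intro φ hφ
    have htest : IsTestFunction (T '' Ω) fun w => J (φ (T.symm w)) := by
      have hts : tsupport (fun w => J (φ (T.symm w))) = T '' tsupport φ := by
        have : Function.support (fun w => J (φ (T.symm w))) = T '' Function.support φ := by
          rw [T.image_eq_preimage_symm]
          ext z
          simp
        rw [tsupport, this, tsupport, T.image_closure]
      refine ⟨J.toContinuousLinearEquiv.contDiff.comp (hφ.1.comp hsmooth), ?_, ?_⟩
      · rw [HasCompactSupport, hts]
        exact hφ.2.1.isCompact.image T.continuous
      · rw [hts]
        exact image_mono hφ.2.2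
    have h2 := hd _ htest
    have h3 := hint fun w => u w * wirtingerBar (fun w => J (φ (T.symm w))) w
    have h4 := hint fun w => f w * J (φ (T.symm w))
    rw [h2] at h3
    simp only [hJmul, hJJ, T.symm_apply_apply] at h3 h4
    rw [map_neg, smul_neg, ← h4] at h3
    have h5 : ∀ z, J (u (T z)) * wirtingerBar φ z
        = β * (J (u (T z)) * J (wirtingerBar (fun w => J (φ (T.symm w))) (T z))) := fun z => by
      rw [← hbar φ hφ.differentiable z]; ring
    simp only [h5]
    rw [integral_const_mul, h3, mul_neg, ← integral_const_mul]
    congr 2 with z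
    ring
  · intro g hg hgm
    have hgm' : MemLp (fun w => J (g (T.symm w))) 2 (volume.restrict (T '' Ω)) := by
      rw [← memLp_comp_iff hk h0 ht]
      simp only [T.symm_apply_apply]
      exact (J.toContinuousLinearEquiv.toContinuousLinearMap).comp_memLp' hgm
    have h2 := ho _ (hhol g hg) hgm'
    have h3 := hint fun w => u w * conj (J (g (T.symm w)))
    rw [h2] at h3
    simpa [hJmul, ← hJc, hJJ] using h3

end Transport

lemma closedRangeConst_le_mul {Ω Ω' : Set ℂ} {b : ℝ≥0} (hb : b ≠ 0)
    (h : ∀ C, HasClosedRangeWith Ω C → HasClosedRangeWith Ω' (b * C)) :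
    closedRangeConst Ω' ≤ b * closedRangeConst Ω := by
  have hb' : (b : ℝ≥0∞) ≠ 0 := by simpa using hb
  rw [closedRangeConst, closedRangeConst, mul_comm, ← ENNReal.div_le_iff hb' ENNReal.coe_ne_top]
  refine le_iInf₂ fun C hC => ?_
  rw [ENNReal.div_le_iff hb' ENNReal.coe_ne_top, mul_comm, ← ENNReal.coe_mul]
  exact iInf₂_le _ (h C hC)

/-! ### Affine maps, conjugation and isometries -/

/-- The affine map `z ↦ a z + b`. -/
noncomputable def affineHomeo (a : ℂ) (ha : a ≠ 0) (b : ℂ) : ℂ ≃ₜ ℂ :=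
  (Homeomorph.mulLeft₀ a ha).trans (Homeomorph.addRight b)

lemma affineHomeo_apply (a : ℂ) (ha : a ≠ 0) (b z : ℂ) : affineHomeo a ha b z = a * z + b := rfl

lemma affineHomeo_symm_apply (a : ℂ) (ha : a ≠ 0) (b z : ℂ) :
    (affineHomeo a ha b).symm z = a⁻¹ * (z - b) := by
  rw [Homeomorph.symm_apply_eq, affineHomeo_apply]
  field_simp
  ring

/-- The value of `k` is left unspecified because it cancels in the transported estimate. -/
lemma exists_map_affineHomeo (a : ℂ) (ha : a ≠ 0) (b : ℂ) :
    ∃ k : ℝ≥0∞, k ≠ 0 ∧ k ≠ ⊤ ∧ Measure.map (affineHomeo a ha b) volume = k • volume := by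
  let f : ℂ →ₗ[ℝ] ℂ := LinearMap.mulLeft ℝ a
  have hf : LinearMap.det f ≠ 0 := by
    have hi : Function.Injective f := fun z w h => mul_left_cancel₀ ha h
    exact (LinearEquiv.isUnit_det' (LinearEquiv.ofInjectiveEndo f hi)).ne_zero
  refine ⟨ENNReal.ofReal |(LinearMap.det f)⁻¹|, by simpa using hf, ENNReal.ofReal_ne_top, ?_⟩
  rw [← Measure.map_linearMap_addHaar_eq_smul_addHaar volume hf]
  have h1 : (affineHomeo a ha b : ℂ → ℂ) = (fun z => z + b) ∘ f := rfl
  have h2 : Measure.map f volume = ENNReal.ofReal |(LinearMap.det f)⁻¹| • volume :=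
    Measure.map_linearMap_addHaar_eq_smul_addHaar volume hf
  have hm : Measurable f := (LinearMap.continuous_of_finiteDimensional f).measurable
  rw [h1, ← Measure.map_map (measurable_add_const b) hm, h2, Measure.map_smul, map_add_right_eq_self]

/-- The inner map is holomorphic with derivative `a`, so in the chain rule only the conjugate
derivative `conj a` survives. -/
lemma wirtingerBar_comp_affine {φ : ℂ → ℂ} (hφ : Differentiable ℝ φ) (a b : ℂ) (z : ℂ) :
    wirtingerBar (fun w => φ (a * (w - b))) z = conj a * wirtingerBar φ (a * (z - b)) := by
  have h1 : HasFDerivAt (fun w : ℂ => a * (w - b)) (a • ContinuousLinearMap.id ℝ ℂ) z :=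
    ((hasFDerivAt_id z).sub_const b).const_mul a
  have h2 := ((hφ (a * (z - b))).hasFDerivAt.comp z h1).fderiv
  set L := fderiv ℝ φ (a * (z - b)) with hL
  have h3 : fderiv ℝ (fun w => φ (a * (w - b))) z = L.comp (a • ContinuousLinearMap.id ℝ ℂ) := h2
  have e1 : a = a.re • (1 : ℂ) + a.im • I := by simp
  have e2 : a * I = (-a.im) • (1 : ℂ) + a.re • I := by
    conv_lhs => rw [← re_add_im a]
    simp only [real_smul]; push_cast; ring_nf; rw [I_sq]; ring
  have e3 : conj a = a.re - a.im * I := by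
    apply Complex.ext <;> simp
  have l1 : L a = a.re * L 1 + a.im * L I := by
    conv_lhs => rw [e1]
    simp only [map_add, map_smul]
    simp only [real_smul]
  have l2 : L (a * I) = -a.im * L 1 + a.re * L I := by
    rw [e2]
    simp only [map_add, map_smul]
    simp only [real_smul]; push_cast; rfl
  simp only [wirtingerBar, h3, ContinuousLinearMap.comp_apply, smul_apply,
    ContinuousLinearMap.id_apply, smul_eq_mul, mul_one, l1, l2, ← hL, e3]
  linear_combination (1 / 2 : ℂ) * a.im * L I * I_sq

lemma closedRangeConst_affine_le (a : ℂ) (ha : a ≠ 0) (b : ℂ) (Ω : Set ℂ) :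
    closedRangeConst ((fun z => a * z + b) '' Ω) ≤ ‖a‖₊ * closedRangeConst Ω := by
  obtain ⟨k, h0, ht, hk⟩ := exists_map_affineHomeo a ha b
  refine closedRangeConst_le_mul (by simpa using ha) fun C hC => ?_
  have hs : ((affineHomeo a ha b).symm : ℂ → ℂ) = fun z => a⁻¹ * (z - b) :=
    funext (affineHomeo_symm_apply a ha b)
  have := HasClosedRangeWith.image (T := affineHomeo a ha b) hk h0 ht
    (J := LinearIsometryEquiv.refl ℝ ℂ) (β := conj a) (fun _ _ => rfl) (fun _ => rfl)
    (fun _ => rfl) ?_ ?_ ?_ hC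
  · rwa [RCLike.nnnorm_conj] at this
  · rw [hs]; fun_prop
  · intro φ hφ z
    simp only [hs, LinearIsometryEquiv.coe_refl, id, wirtingerBar_comp_affine hφ, affineHomeo_apply]
    rw [← mul_assoc, ← map_mul, mul_inv_cancel₀ ha, map_one, one_mul]
    congr 1
    field_simp
    ring
  · intro g hg
    simp only [hs, LinearIsometryEquiv.coe_refl, id]
    refine hg.comp (by fun_prop) ?_
    rintro _ ⟨z, hz, rfl⟩
    rw [affineHomeo_apply]
    convert hz using 1
    field_simp
    ring

/-- Scaling of the closed range constant under affine maps. -/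
lemma closedRangeConst_affine (a : ℂ) (ha : a ≠ 0) (b : ℂ) (Ω : Set ℂ) :
    closedRangeConst ((fun z => a * z + b) '' Ω) = ‖a‖₊ * closedRangeConst Ω := by
  refine le_antisymm (closedRangeConst_affine_le a ha b Ω) ?_
  have h := closedRangeConst_affine_le a⁻¹ (inv_ne_zero ha) (-(a⁻¹ * b))
    ((fun z => a * z + b) '' Ω)
  rw [image_image] at h
  have h2 : (fun z => a⁻¹ * (a * z + b) + -(a⁻¹ * b)) = id := by
    ext z; simp only [id]; field_simp; ring
  rw [h2, image_id, nnnorm_inv, ENNReal.coe_inv (by simpa using ha), mul_comm,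
    ← div_eq_mul_inv, ENNReal.le_div_iff_mul_le (by simp [ha]) (by simp)] at h
  rwa [mul_comm]

/-- A single conjugation, inside or outside, exchanges `∂` and `∂̄`; two of them restore `∂̄`. -/
lemma wirtingerBar_conj_comp_conj {φ : ℂ → ℂ} (hφ : Differentiable ℝ φ) (z : ℂ) :
    wirtingerBar (fun w => conj (φ (conj w))) z = conj (wirtingerBar φ (conj z)) := by
  have h1 : HasFDerivAt (fun w : ℂ => conj w) (conjCLE : ℂ →L[ℝ] ℂ) z := conjCLE.hasFDerivAt
  have h2 : HasFDerivAt (fun w : ℂ => conj w) (conjCLE : ℂ →L[ℝ] ℂ) (φ (conj z)) :=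
    conjCLE.hasFDerivAt
  have h3 := (h2.comp z ((hφ (conj z)).hasFDerivAt.comp z h1)).fderiv
  have h4 : fderiv ℝ (fun w => conj (φ (conj w))) z = _ := h3
  have h5 : conj (2 : ℂ) = 2 := conj_ofNat 2
  simp [wirtingerBar, h4, h5]

lemma closedRangeConst_conj_le {Ω : Set ℂ} (hΩ : IsOpen Ω) :
    closedRangeConst ((fun z => conj z) '' Ω) ≤ closedRangeConst Ω := by
  have h := closedRangeConst_le_mul (Ω := Ω) (Ω' := (fun z => conj z) '' Ω) (b := 1) one_ne_zero
    fun C hC => ?_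
  · simpa using h
  · have := HasClosedRangeWith.image (T := conjLIE.toHomeomorph) (k := 1) ?_ one_ne_zero
      ENNReal.one_ne_top (J := conjLIE) (β := 1) ?_ ?_ ?_ ?_ ?_ ?_ hC
    · rwa [nnnorm_one] at this
    · rw [one_smul]; exact conjLIE.measurePreserving.map_eq
    · intro z w; simp
    · intro z; simp
    · intro z; simp
    · exact conjCLE.contDiff
    · intro φ hφ z
      have := wirtingerBar_conj_comp_conj hφ (conj z)
      rw [one_mul]
      change conj (wirtingerBar (fun w => conj (φ (conj w))) (conj z)) = _
      rw [this, conj_conj, conj_conj]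
    · intro g hg
      rintro _ ⟨z, hz, rfl⟩
      exact (hg.differentiableAt (hΩ.mem_nhds hz)).conj_conj.differentiableWithinAt

lemma closedRangeConst_conj {Ω : Set ℂ} (hΩ : IsOpen Ω) :
    closedRangeConst ((fun z => conj z) '' Ω) = closedRangeConst Ω := by
  refine le_antisymm (closedRangeConst_conj_le hΩ) ?_
  have h := closedRangeConst_conj_le (conjLIE.toHomeomorph.isOpenMap Ω hΩ)
  change closedRangeConst ((fun z => conj z) '' ((fun z => conj z) '' Ω)) ≤
    closedRangeConst ((fun z => conj z) '' Ω) at h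
  rw [image_image] at h
  simp only [conj_conj, image_id'] at h
  exact h

/-- By Mazur–Ulam `T` is real affine, and its linear part is a rotation, possibly after conjugation.
Both kinds of factor leave the constant unchanged. -/
theorem closedRangeConst_isometry (T : ℂ ≃ᵢ ℂ) {Ω : Set ℂ} (hΩ : IsOpen Ω) :
    closedRangeConst (T '' Ω) = closedRangeConst Ω := by
  let A := T.toRealAffineIsometryEquiv
  have hT : ∀ z, T z = A.linearIsometryEquiv z + T 0 := by
    intro z
    have := A.map_vadd 0 z
    simpa [A] using this
  obtain ⟨a, ha⟩ := linear_isometry_complex A.linearIsometryEquiv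
  have ha0 : (a : ℂ) ≠ 0 := a.coe_ne_zero
  have ha1 : ‖(a : ℂ)‖₊ = 1 := by ext; exact a.norm_coe
  rcases ha with ha | ha
  · have h1 : (T : ℂ → ℂ) = fun z => a * z + T 0 := by
      ext z; rw [hT, ha]; simp
    rw [h1, closedRangeConst_affine a ha0, ha1]; simp
  · have h1 : (T : ℂ → ℂ) = (fun z => a * z + T 0) ∘ fun z => conj z := by
      ext z; rw [hT, ha]; simp
    rw [h1, image_comp, closedRangeConst_affine a ha0, ha1, closedRangeConst_conj hΩ]; simp

theorem closedRangeConst_real_mul {r : ℝ} (hr : 0 < r) (Ω : Set ℂ) :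
    closedRangeConst ((fun z : ℂ => (r : ℂ) * z) '' Ω)
      = ENNReal.ofReal r * closedRangeConst Ω := by
  have h := closedRangeConst_affine (r : ℂ) (by exact_mod_cast hr.ne') 0 Ω
  simp only [add_zero] at h
  rw [h, ENNReal.ofReal, Real.toNNReal_of_nonneg hr.le]
  congr 2
  ext
  simp [abs_of_pos hr]

end DbarPlane

/-! ### Equilibrium measures and the energy of polar sets -/

namespace DbarPlane

open Complex Set Metric Filter Topology

section Energy

variable {X : Type*} [TopologicalSpace X] [CompactSpace X] [TopologicalSpace.MetrizableSpace X]
  [MeasurableSpace X] [BorelSpace X]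

/-- The mutual energy `∬ c dμ dμ` for a kernel `c`. -/
noncomputable def kernelEnergy (c : X × X → ℝ) (μ : Measure X) : ℝ := ∫ p, c p ∂(μ.prod μ)

lemma integrable_of_continuous {Y : Type*} [TopologicalSpace Y] [CompactSpace Y]
    [MeasurableSpace Y] [BorelSpace Y] [TopologicalSpace.PseudoMetrizableSpace Y]
    (μ : Measure Y) [IsFiniteMeasure μ] {c : Y → ℝ} (hc : Continuous c) : Integrable c μ := by
  let := TopologicalSpace.pseudoMetrizableSpacePseudoMetric Y
  exact (BoundedContinuousFunction.mkOfCompact ⟨c, hc⟩).integrable μ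

/-- The map `μ ↦ μ.prod μ` is weakly continuous, and a continuous kernel on a compact space is an
admissible test function. -/
lemma continuous_kernelEnergy {c : X × X → ℝ} (hc : Continuous c) :
    Continuous fun μ : ProbabilityMeasure X => kernelEnergy c μ := by
  have h1 : Continuous fun μ : ProbabilityMeasure X => μ.prod μ :=
    ProbabilityMeasure.continuous_prod.comp (continuous_id.prodMk continuous_id)
  exact (ProbabilityMeasure.continuous_integral_boundedContinuousFunction
    (BoundedContinuousFunction.mkOfCompact ⟨c, hc⟩)).comp h1

/-- An equilibrium measure for a continuous symmetric kernel: it minimizes the energy, and its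
potential is bounded below by the energy. -/
lemma exists_equilibrium [Nonempty X] {c : X × X → ℝ} (hc : Continuous c)
    (hsymm : ∀ x y, c (x, y) = c (y, x)) :
    ∃ μ : ProbabilityMeasure X, (∀ ν : ProbabilityMeasure X, kernelEnergy c μ ≤ kernelEnergy c ν) ∧
      ∀ x, kernelEnergy c μ ≤ ∫ y, c (x, y) ∂(μ : Measure X) := by
  have : Nonempty (ProbabilityMeasure X) :=
    ⟨⟨Measure.dirac (Classical.arbitrary X), inferInstance⟩⟩
  obtain ⟨μ, -, hμ⟩ := isCompact_univ.exists_isMinOn (univ_nonempty)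
    (continuous_kernelEnergy hc).continuousOn
  have hmin : ∀ ν : ProbabilityMeasure X, kernelEnergy c μ ≤ kernelEnergy c ν :=
    fun ν => hμ (mem_univ ν)
  refine ⟨μ, hmin, fun x => ?_⟩
  set E := kernelEnergy c μ with hE
  set U := ∫ y, c (x, y) ∂(μ : Measure X) with hU
  -- First variation in the direction of the point mass at `x`: the energy of `(1 - t) μ + t δ_x`
  -- minus `E`, divided by `t`. The mass `δ_x` is admissible because the kernel is finite on the
  -- diagonal.
  have key : ∀ t : ℝ, 0 < t → t < 1 → 0 ≤ (2 * (U - E)) + t * (E - 2 * U + c (x, x)) := by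
    intro t ht0 ht1
    set a : ℝ≥0 := ⟨1 - t, by linarith⟩ with ha
    set b : ℝ≥0 := ⟨t, ht0.le⟩ with hb
    have hab : a + b = 1 := NNReal.eq (sub_add_cancel 1 t)
    set ν : Measure X := a • (μ : Measure X) + b • Measure.dirac x with hν
    have hνp : IsProbabilityMeasure ν := by
      constructor
      rw [hν, Measure.add_apply, Measure.smul_apply, Measure.smul_apply, measure_univ, measure_univ,
        ← add_smul, hab, one_smul]
    have h1 := hmin ⟨ν, hνp⟩
    have hcx : ∀ z, Continuous fun y => c (z, y) := fun z => hc.comp (Continuous.prodMk_right z)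
    have hi : ∀ z, ∫ y, c (z, y) ∂ν = (1 - t) * ∫ y, c (z, y) ∂(μ : Measure X) + t * c (z, x) := by
      intro z
      rw [hν, integral_add_measure (integrable_of_continuous _ (hcx z))
        (integrable_of_continuous _ (hcx z)), integral_smul_nnreal_measure,
        integral_smul_nnreal_measure, integral_dirac]
      rfl
    have hci : Integrable c ((μ : Measure X).prod μ) := integrable_of_continuous _ hc
    have hi1 : Integrable (fun z => ∫ y, c (z, y) ∂(μ : Measure X)) μ := hci.integral_prod_left
    have hi2 : Integrable (fun z => c (z, x)) (μ : Measure X) :=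
      integrable_of_continuous _ (hc.comp (Continuous.prodMk_left x))
    have hcν : Integrable c (ν.prod ν) := integrable_of_continuous _ hc
    have h2 : kernelEnergy c ν = (1 - t) * ((1 - t) * E + t * U) + t * ((1 - t) * U + t * c (x, x)) := by
      have hint := hcν.integral_prod_left
      have hint1 := hint
      simp only [hν, integrable_add_measure] at hint1
      rw [kernelEnergy, integral_prod _ hcν]
      conv_lhs => rw [hν]
      rw [integral_add_measure hint1.1 hint1.2, integral_smul_nnreal_measure,
        integral_smul_nnreal_measure, integral_dirac, ← hν]
      simp only [hi]
      rw [integral_add (hi1.const_mul _) (hi2.const_mul _), integral_const_mul, integral_const_mul,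
        ← integral_prod _ hci]
      simp only [hsymm _ x]
      rfl
    change E ≤ kernelEnergy c ν at h1
    rw [h2] at h1
    have h3 : 0 ≤ t * ((2 * (U - E)) + t * (E - 2 * U + c (x, x))) := by nlinarith
    exact nonneg_of_mul_nonneg_right h3 ht0
  have hlim : Tendsto (fun t : ℝ => (2 * (U - E)) + t * (E - 2 * U + c (x, x))) (𝓝[>] 0)
      (𝓝 (2 * (U - E) + 0 * (E - 2 * U + c (x, x)))) :=
    (Continuous.tendsto (by fun_prop) 0).mono_left nhdsWithin_le_nhds
  have := ge_of_tendsto hlim (by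
    filter_upwards [Ioo_mem_nhdsGT one_pos] with t ht using key t ht.1 ht.2)
  linarith

end Energy

/-- On a polar set, every nontrivial finite measure with compact support has infinite logarithmic
energy, in terms of `lintegral`. -/
lemma IsPolar.lintegral_eq_top {E : Set ℂ} (hE : IsPolar E) {μ : Measure ℂ} [IsFiniteMeasure μ]
    (h0 : μ ≠ 0) (hc : IsCompact μ.support) (hs : μ.support ⊆ E) :
    ∫⁻ z, ∫⁻ w, (-ENNReal.log ‖z - w‖ₑ).toENNReal ∂μ ∂μ = ⊤ := by
  have h := hE μ inferInstance h0 hc hs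
  by_contra hne
  -- The negative part of the potential is at most the integral of the negative part of the
  -- logarithm, so finiteness of the latter double integral would exclude energy `⊥`.
  have hle : ∫⁻ z, (-logPotential μ z).toENNReal ∂μ
      ≤ ∫⁻ z, ∫⁻ w, (-ENNReal.log ‖z - w‖ₑ).toENNReal ∂μ ∂μ := by
    refine lintegral_mono fun z => ?_
    rw [logPotential, erealIntegral]
    set a := ∫⁻ w, (ENNReal.log ‖z - w‖ₑ).toENNReal ∂μ
    set b := ∫⁻ w, (-ENNReal.log ‖z - w‖ₑ).toENNReal ∂μ
    have hab : -((a : EReal) - b) ≤ b := by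
      rcases eq_or_ne b ⊤ with hb | hb
      · rw [hb]; exact le_top
      · rw [EReal.neg_sub (Or.inl (EReal.coe_ennreal_ne_bot a))
          (Or.inr (by simpa using hb))]
        calc -(a : EReal) + b ≤ 0 + b := by gcongr; simpa using EReal.coe_ennreal_nonneg a
          _ = b := zero_add _
    exact (EReal.toENNReal_le_toENNReal hab).trans_eq EReal.toENNReal_coe
  rw [logEnergy, erealIntegral, sub_eq_add_neg, EReal.add_eq_bot_iff, EReal.neg_eq_bot_iff] at h
  rcases h with h | h
  · exact EReal.coe_ennreal_ne_bot _ h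
  · rw [EReal.coe_ennreal_eq_top_iff] at h
    exact hne (top_le_iff.1 (h ▸ hle))

end DbarPlane

/-! ### Estimates for the regularized logarithmic kernel -/

namespace DbarPlane

open Complex Set Metric Filter Topology

lemma lintegral_one_div_max {m R : ℝ} (hm : 0 < m) (hmR : m ≤ R) :
    ∫⁻ s in Ioc 0 R, ENNReal.ofReal (1 / max s m) = ENNReal.ofReal (1 + Real.log (R / m)) := by
  have hcont : Continuous fun s : ℝ => 1 / max s m :=
    continuous_const.div (by fun_prop) fun s => (lt_max_of_lt_right hm).ne'
  have hR : 0 < R := hm.trans_le hmR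
  rw [← ofReal_integral_eq_lintegral_ofReal
    ((hcont.intervalIntegrable 0 R).1)
    (Eventually.of_forall fun s => by
      have : 0 < max s m := lt_max_of_lt_right hm
      change 0 ≤ 1 / max s m
      positivity),
    ← intervalIntegral.integral_of_le hR.le,
    ← intervalIntegral.integral_add_adjacent_intervals (hcont.intervalIntegrable 0 m)
      (hcont.intervalIntegrable m R)]
  congr 2
  · rw [intervalIntegral.integral_congr (g := fun _ => 1 / m)]
    · simp [hm.ne']
    · intro s hs
      rw [uIcc_of_le hm.le] at hs
      simp only [max_eq_right hs.2]
  · rw [intervalIntegral.integral_congr (g := fun s => 1 / s)]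
    · rw [integral_one_div_of_pos hm hR]
    · intro s hs
      rw [uIcc_of_le hmR] at hs
      simp only [max_eq_left hs.1]

/-- In polar coordinates the Jacobian cancels `‖t‖`. The angle contributes `2 π`, and splitting the
radial integral at `m` gives `1` plus the logarithm. -/
lemma lintegral_ball_one_div_mul_max_le {m R : ℝ} (hm : 0 < m) (hmR : m ≤ R) :
    ∫⁻ t in ball (0 : ℂ) R, ENNReal.ofReal (1 / (‖t‖ * max ‖t‖ m))
      ≤ ENNReal.ofReal (2 * Real.pi * (1 + Real.log (R / m))) := by
  rw [← lintegral_indicator measurableSet_ball, ← Complex.lintegral_comp_polarCoord_symm]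
  have hmeas : Measurable fun s : ℝ => ENNReal.ofReal (1 / max s m) := by fun_prop
  have hle : ∀ p ∈ polarCoord.target, ENNReal.ofReal p.1 •
      (ball (0 : ℂ) R).indicator (fun t => ENNReal.ofReal (1 / (‖t‖ * max ‖t‖ m)))
        (Complex.polarCoord.symm p)
      ≤ (Ioc 0 R ×ˢ Ioo (-Real.pi) Real.pi).indicator
        (fun p : ℝ × ℝ => ENNReal.ofReal (1 / max p.1 m)) p := by
    rintro ⟨r, θ⟩ ⟨hr, hθ⟩
    have hr0 : 0 < r := hr
    have hn : ‖Complex.polarCoord.symm (r, θ)‖ = r := by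
      rw [Complex.norm_polarCoord_symm, abs_of_pos hr0]
    by_cases hb : Complex.polarCoord.symm (r, θ) ∈ ball (0 : ℂ) R
    · rw [indicator_of_mem hb, hn, indicator_of_mem, smul_eq_mul, ← ENNReal.ofReal_mul hr0.le]
      · refine ENNReal.ofReal_le_ofReal (le_of_eq ?_)
        have : 0 < max r m := lt_max_of_lt_right hm
        field_simp
      · rw [mem_ball_zero_iff, hn] at hb
        exact ⟨⟨hr0, hb.le⟩, hθ⟩
    · rw [indicator_of_notMem hb, smul_zero]
      exact zero_le
  refine (setLIntegral_mono' polarCoord.open_target.measurableSet hle).trans ?_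
  refine (setLIntegral_le_lintegral _ _).trans ?_
  rw [lintegral_indicator (measurableSet_Ioc.prod measurableSet_Ioo), Measure.volume_eq_prod,
    ← Measure.prod_restrict, lintegral_prod _ (by fun_prop)]
  simp only [lintegral_const, Measure.restrict_apply_univ, Real.volume_Ioo]
  rw [lintegral_mul_const _ hmeas, lintegral_one_div_max hm hmR, mul_comm,
    ← ENNReal.ofReal_mul (by linarith [Real.pi_pos])]
  refine ENNReal.ofReal_le_ofReal (le_of_eq ?_)
  ring

/-- The regularized logarithmic kernel `log (4 R) - log √(|z|² + ε²)`. -/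
noncomputable def logKernel (R ε : ℝ) (z : ℂ) : ℝ :=
  Real.log (4 * R) - Real.log (‖z‖ ^ 2 + ε ^ 2) / 2

lemma contDiff_logKernel (R : ℝ) {ε : ℝ} (hε : 0 < ε) : ContDiff ℝ ∞ (logKernel R ε) := by
  unfold logKernel
  refine contDiff_const.sub (ContDiff.div_const (ContDiff.log ?_ fun z => by positivity) _)
  exact (contDiff_norm_sq ℝ).add contDiff_const

lemma logKernel_neg (R ε : ℝ) (z : ℂ) : logKernel R ε (-z) = logKernel R ε z := by
  simp [logKernel]

lemma logKernel_anti (R : ℝ) {ε δ : ℝ} (hε : 0 < ε) (h : ε ≤ δ) (z : ℂ) :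
    logKernel R δ z ≤ logKernel R ε z := by
  unfold logKernel
  gcongr

lemma logKernel_nonneg {R ε : ℝ} (hR : 1 ≤ R) (hε : 0 < ε) (hε1 : ε ≤ 1) {z : ℂ}
    (hz : ‖z‖ ≤ 2 * R) : 0 ≤ logKernel R ε z := by
  have h1 : Real.log (‖z‖ ^ 2 + ε ^ 2) ≤ Real.log ((4 * R) ^ 2) := by
    refine Real.log_le_log (by positivity) ?_
    have := norm_nonneg z
    nlinarith
  rw [Real.log_pow] at h1
  push_cast at h1
  unfold logKernel
  linarith

lemma logKernel_le {R ε d : ℝ} (hd : 0 < d) {z : ℂ} (hz : d ≤ ‖z‖) :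
    logKernel R ε z ≤ Real.log (4 * R) - Real.log d := by
  have h1 : Real.log (d ^ 2) ≤ Real.log (‖z‖ ^ 2 + ε ^ 2) := by
    refine Real.log_le_log (by positivity) ?_
    have : d ^ 2 ≤ ‖z‖ ^ 2 := by gcongr
    nlinarith [sq_nonneg ε]
  rw [Real.log_pow] at h1
  push_cast at h1
  unfold logKernel
  linarith

lemma norm_fderiv_logKernel_le (R : ℝ) {ε : ℝ} (hε : 0 < ε) (z : ℂ) :
    ‖fderiv ℝ (logKernel R ε) z‖ ≤ 1 / √(‖z‖ ^ 2 + ε ^ 2) := by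
  have hpos : 0 < ‖z‖ ^ 2 + ε ^ 2 := by positivity
  have h1 : HasFDerivAt (fun z : ℂ => ‖z‖ ^ 2 + ε ^ 2) ((2 : ℝ) • innerSL ℝ z) z := by
    simpa [two_smul] using! (hasStrictFDerivAt_norm_sq z).hasFDerivAt.add_const (ε ^ 2)
  have h2 : HasFDerivAt (logKernel R ε)
      (-((2⁻¹ : ℝ) • ((‖z‖ ^ 2 + ε ^ 2)⁻¹ • ((2 : ℝ) • innerSL ℝ z)))) z := by
    have := ((h1.log hpos.ne').mul_const (2⁻¹ : ℝ)).const_sub (Real.log (4 * R))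
    exact this
  rw [h2.fderiv, norm_neg, norm_smul, norm_smul, norm_smul, innerSL_apply_norm]
  rw [norm_inv, norm_inv, Real.norm_of_nonneg (r := ‖z‖ ^ 2 + ε ^ 2) hpos.le, le_div_iff₀ (by positivity)]
  have hs : √(‖z‖ ^ 2 + ε ^ 2) * √(‖z‖ ^ 2 + ε ^ 2) = ‖z‖ ^ 2 + ε ^ 2 :=
    Real.mul_self_sqrt hpos.le
  have hz : ‖z‖ ≤ √(‖z‖ ^ 2 + ε ^ 2) := Real.le_sqrt_of_sq_le (by nlinarith)
  have hsp : 0 < √(‖z‖ ^ 2 + ε ^ 2) := by positivity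
  have e : ‖(2 : ℝ)‖⁻¹ * ((‖z‖ ^ 2 + ε ^ 2)⁻¹ * (‖(2 : ℝ)‖ * ‖z‖)) * √(‖z‖ ^ 2 + ε ^ 2)
      = ‖z‖ / √(‖z‖ ^ 2 + ε ^ 2) := by
    rw [← hs]
    norm_num
    field_simp
  rw [e]
  exact div_le_one_of_le₀ hz hsp.le

/-- The nearer point `x` supplies the factor `‖t - x‖`; the distance to `y` is at least both `‖t -
x‖` and `‖x - y‖ / 2`. -/
lemma one_div_sqrt_mul_le {ε : ℝ} (hε : 0 < ε) {x y t : ℂ} (hx : t ≠ x) (hxy : ‖t - x‖ ≤ ‖t - y‖) :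
    (1 / √(‖t - x‖ ^ 2 + ε ^ 2)) * (1 / √(‖t - y‖ ^ 2 + ε ^ 2))
      ≤ 1 / (‖t - x‖ * max ‖t - x‖ (√(‖x - y‖ ^ 2 + ε ^ 2) / 2)) := by
  have hs : 0 < ‖t - x‖ := norm_pos_iff.2 (sub_ne_zero.2 hx)
  rw [one_div_mul_one_div]
  have h1 : ‖t - x‖ ≤ √(‖t - x‖ ^ 2 + ε ^ 2) := Real.le_sqrt_of_sq_le (by nlinarith)
  have h2 : ‖x - y‖ ≤ 2 * ‖t - y‖ := by
    have := norm_sub_le (t - y) (t - x)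
    rw [sub_sub_sub_cancel_left] at this
    linarith
  have h3 : max ‖t - x‖ (√(‖x - y‖ ^ 2 + ε ^ 2) / 2) ≤ √(‖t - y‖ ^ 2 + ε ^ 2) := by
    refine max_le (Real.le_sqrt_of_sq_le (by nlinarith)) ?_
    rw [div_le_iff₀ two_pos, Real.sqrt_le_left (by positivity), mul_pow,
      Real.sq_sqrt (by positivity)]
    have : ‖x - y‖ ^ 2 ≤ (2 * ‖t - y‖) ^ 2 := by gcongr
    nlinarith [sq_nonneg ε]
  have h4 : 0 < max ‖t - x‖ (√(‖x - y‖ ^ 2 + ε ^ 2) / 2) := lt_max_of_lt_left hs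
  gcongr

/-- The mutual Dirichlet energy of two regularized logarithmic kernels is controlled by the kernel
itself. -/
lemma lintegral_ball_kernel_mul_le {R ε : ℝ} (hR : 1 ≤ R) (hε : 0 < ε) (hε1 : ε ≤ 1) {x y : ℂ}
    (hx : ‖x‖ ≤ R) (hy : ‖y‖ ≤ R) :
    ∫⁻ t in ball (0 : ℂ) R, ENNReal.ofReal (1 / √(‖t - x‖ ^ 2 + ε ^ 2)) *
        ENNReal.ofReal (1 / √(‖t - y‖ ^ 2 + ε ^ 2))
      ≤ ENNReal.ofReal (4 * Real.pi * (1 + logKernel R ε (x - y))) := by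
  set m := √(‖x - y‖ ^ 2 + ε ^ 2) / 2 with hm
  have hm0 : 0 < m := by positivity
  have hxy : ‖x - y‖ ≤ 2 * R := (norm_sub_le x y).trans (by linarith)
  have hmR : m ≤ 2 * R := by
    rw [hm, div_le_iff₀ two_pos, Real.sqrt_le_left (by positivity)]
    have := norm_nonneg (x - y)
    nlinarith
  -- The normalization `4 * R` of the kernel makes this an equality.
  have hlog : Real.log (2 * R / m) = logKernel R ε (x - y) := by
    rw [hm, logKernel, div_div_eq_mul_div, Real.log_div (by positivity) (by positivity),
      Real.log_sqrt (by positivity)]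
    congr 2
    ring
  have hF : ∀ v : ℂ, ‖v‖ ≤ R →
      ∫⁻ t in ball (0 : ℂ) R, ENNReal.ofReal (1 / (‖t - v‖ * max ‖t - v‖ m))
        ≤ ENNReal.ofReal (2 * Real.pi * (1 + logKernel R ε (x - y))) := by
    intro v hv
    rw [← lintegral_indicator measurableSet_ball]
    calc _ ≤ ∫⁻ t, (ball (0 : ℂ) (2 * R)).indicator
            (fun t => ENNReal.ofReal (1 / (‖t‖ * max ‖t‖ m))) (t - v) := by
          refine lintegral_mono fun t => ?_
          by_cases ht : t ∈ ball (0 : ℂ) R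
          · have : t - v ∈ ball (0 : ℂ) (2 * R) := by
              rw [mem_ball_zero_iff] at ht ⊢
              exact (norm_sub_le t v).trans_lt (by linarith)
            rw [indicator_of_mem ht, indicator_of_mem this]
          · rw [indicator_of_notMem ht]
            exact zero_le
      _ = ∫⁻ t in ball (0 : ℂ) (2 * R), ENNReal.ofReal (1 / (‖t‖ * max ‖t‖ m)) := by
          rw [lintegral_sub_right_eq_self, lintegral_indicator measurableSet_ball]
      _ ≤ _ := hlog ▸ lintegral_ball_one_div_mul_max_le hm0 hmR
  have hne : ∀ x : ℂ, ∀ᵐ t, t ≠ x := fun x => by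
    rw [ae_iff]; simp
  calc _ ≤ ∫⁻ t in ball (0 : ℂ) R, (ENNReal.ofReal (1 / (‖t - x‖ * max ‖t - x‖ m)) +
          ENNReal.ofReal (1 / (‖t - y‖ * max ‖t - y‖ m))) := by
        refine lintegral_mono_ae (ae_restrict_of_ae ?_)
        filter_upwards [hne x, hne y] with t htx hty
        rw [← ENNReal.ofReal_mul (by positivity)]
        rcases le_total ‖t - x‖ ‖t - y‖ with h | h
        · exact (ENNReal.ofReal_le_ofReal (one_div_sqrt_mul_le hε htx h)).trans le_self_add
        · rw [mul_comm, hm, norm_sub_rev x y]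
          exact (ENNReal.ofReal_le_ofReal (one_div_sqrt_mul_le hε hty h)).trans le_add_self
    _ ≤ ENNReal.ofReal (2 * Real.pi * (1 + logKernel R ε (x - y))) +
          ENNReal.ofReal (2 * Real.pi * (1 + logKernel R ε (x - y))) := by
        rw [lintegral_add_left (by fun_prop)]
        exact add_le_add (hF x hx) (hF y hy)
    _ = _ := by
        have := logKernel_nonneg hR hε hε1 hxy
        have := Real.pi_pos
        rw [← ENNReal.ofReal_add (by positivity) (by positivity)]
        congr 1
        ring

end DbarPlane

/-! ### Equilibrium potentials of compact polar sets -/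

namespace DbarPlane

open Complex Set Metric Filter Topology

/-- The kernel `logKernel` restricted to a subset of the plane. -/
noncomputable def subtypeKernel (K : Set ℂ) (R ε : ℝ) (p : K × K) : ℝ :=
  logKernel R ε (p.1 - p.2)

lemma continuous_subtypeKernel (K : Set ℂ) (R : ℝ) {ε : ℝ} (hε : 0 < ε) :
    Continuous (subtypeKernel K R ε) :=
  (contDiff_logKernel R hε).continuous.comp (by fun_prop)

/-- The limit is `log (4 R) - log ‖z‖`, read as `⊤` at the origin, and `log (4 R) ≥ 0`. -/
lemma tendsto_ofReal_logKernel {R : ℝ} (hR : 1 ≤ R) {ε : ℕ → ℝ} (hε : ∀ n, 0 < ε n)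
    (hlim : Tendsto ε atTop (𝓝 0)) (z : ℂ) :
    ∃ a, Tendsto (fun n => ENNReal.ofReal (logKernel R (ε n) z)) atTop (𝓝 a) ∧
      (-ENNReal.log ‖z‖ₑ).toENNReal ≤ a := by
  have h1 : Tendsto (fun n => ‖z‖ ^ 2 + ε n ^ 2) atTop (𝓝 (‖z‖ ^ 2)) := by
    simpa using (hlim.pow 2).const_add (‖z‖ ^ 2)
  by_cases hz : z = 0
  · refine ⟨⊤, ?_, le_top⟩
    subst hz
    have h2 : Tendsto (fun n => ‖(0 : ℂ)‖ ^ 2 + ε n ^ 2) atTop (𝓝[>] 0) := by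
      refine tendsto_nhdsWithin_iff.2 ⟨by simpa using h1, Eventually.of_forall fun n => ?_⟩
      have := hε n
      simp only [mem_Ioi]
      positivity
    refine ENNReal.tendsto_ofReal_atTop.comp ?_
    unfold logKernel
    have h3 := ((Real.tendsto_log_nhdsGT_zero.comp h2).const_mul_atBot
      (r := (1 / 2 : ℝ)) (by norm_num))
    have h4 := tendsto_atTop_add_const_left _ (Real.log (4 * R)) (tendsto_neg_atBot_atTop.comp h3)
    refine h4.congr fun n => ?_
    simp only [Function.comp]
    ring
  · have hz0 : 0 < ‖z‖ := norm_pos_iff.2 hz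
    refine ⟨ENNReal.ofReal (Real.log (4 * R) - Real.log (‖z‖ ^ 2) / 2), ?_, ?_⟩
    · refine (ENNReal.continuous_ofReal.tendsto _).comp ?_
      exact ((h1.log (by positivity)).div_const 2).const_sub _
    · have h2 : ENNReal.log ‖z‖ₑ = (Real.log ‖z‖ : EReal) := by
        rw [← ofReal_norm, ENNReal.log_ofReal_of_pos hz0]
      rw [h2, ← EReal.coe_neg, EReal.real_coe_toENNReal, Real.log_pow]
      refine ENNReal.ofReal_le_ofReal ?_
      have : 0 ≤ Real.log (4 * R) := Real.log_nonneg (by linarith)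
      push_cast
      linarith

lemma support_map_subtype_subset {K : Set ℂ} (hK : IsCompact K) (μ : Measure K) :
    (Measure.map (Subtype.val : K → ℂ) μ).support ⊆ K := by
  refine Measure.support_subset_of_isClosed hK.isClosed ?_
  rw [mem_ae_iff, Measure.map_apply measurable_subtype_coe hK.isClosed.measurableSet.compl]
  simp

/-- The regularized energies of probability measures on a compact polar set tend to infinity
uniformly. -/
lemma exists_forall_lt_kernelEnergy {E K : Set ℂ} (hE : IsPolar E) (hK : IsCompact K) (hKE : K ⊆ E)
    {R : ℝ} (hR : 1 ≤ R) (hKR : K ⊆ closedBall 0 R) (M : ℝ) :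
    ∃ ε : ℝ, 0 < ε ∧ ε ≤ 1 ∧ ∀ μ : ProbabilityMeasure K,
      M < kernelEnergy (subtypeKernel K R ε) (μ : Measure K) := by
  have : CompactSpace K := isCompact_iff_compactSpace.1 hK
  set ε : ℕ → ℝ := fun n => 1 / ((n : ℝ) + 1) with hε
  have hε0 : ∀ n, 0 < ε n := fun n => Nat.one_div_pos_of_nat
  have hεa : Antitone ε := fun a b h => Nat.one_div_le_one_div h
  have hε1 : ∀ n, ε n ≤ 1 := fun n => by simpa [hε] using hεa (Nat.zero_le n)
  by_contra hcon
  push Not at hcon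
  have hnorm : ∀ p : K × K, ‖(p.1 - p.2 : ℂ)‖ ≤ 2 * R := fun p => by
    have h1 := mem_closedBall_zero_iff.1 (hKR p.1.2)
    have h2 := mem_closedBall_zero_iff.1 (hKR p.2.2)
    exact (norm_sub_le _ _).trans (by linarith)
  -- If the claim fails, these sublevel sets are nonempty, closed and nested in a compact space. A
  -- common element has finite logarithmic energy by Fatou, which contradicts polarity.
  let S : ℕ → Set (ProbabilityMeasure K) := fun n =>
    {μ | kernelEnergy (subtypeKernel K R (ε n)) (μ : Measure K) ≤ M}
  have hSc : ∀ n, IsClosed (S n) := fun n =>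
    isClosed_le (continuous_kernelEnergy (continuous_subtypeKernel K R (hε0 n))) continuous_const
  have hSanti : ∀ n, S (n + 1) ⊆ S n := fun n μ hμ => by
    refine le_trans ?_ (show kernelEnergy (subtypeKernel K R (ε (n + 1))) (μ : Measure K) ≤ M from hμ)
    refine integral_mono (integrable_of_continuous _ (continuous_subtypeKernel K R (hε0 n)))
      (integrable_of_continuous _ (continuous_subtypeKernel K R (hε0 (n + 1)))) fun p => ?_
    exact logKernel_anti R (hε0 _) (hεa (Nat.le_succ n)) _
  obtain ⟨μ, hμ⟩ := IsCompact.nonempty_iInter_of_sequence_nonempty_isCompact_isClosed S hSanti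
    (fun n => hcon (ε n) (hε0 n) (hε1 n)) (hSc 0).isCompact hSc
  have hμn : ∀ n, kernelEnergy (subtypeKernel K R (ε n)) (μ : Measure K) ≤ M := fun n =>
    mem_iInter.1 hμ n
  set ν : Measure ℂ := Measure.map (Subtype.val : K → ℂ) (μ : Measure K) with hν
  have hνp : IsProbabilityMeasure ν := Measure.isProbabilityMeasure_map (by fun_prop)
  have hνs : ν.support ⊆ K := support_map_subtype_subset hK _
  have htop := hE.lintegral_eq_top (μ := ν) (IsProbabilityMeasure.ne_zero ν)
    (hK.of_isClosed_subset Measure.isClosed_support hνs) (hνs.trans hKE)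
  have hval : MeasurableEmbedding (Subtype.val : K → ℂ) :=
    MeasurableEmbedding.subtype_coe hK.isClosed.measurableSet
  have hmeas : ∀ n, Measurable fun p : K × K => ENNReal.ofReal (subtypeKernel K R (ε n) p) :=
    fun n => (continuous_subtypeKernel K R (hε0 n)).measurable.ennreal_ofReal
  have hmeasl : Measurable fun p : K × K => (-ENNReal.log ‖(p.1 - p.2 : ℂ)‖ₑ).toENNReal := by
    fun_prop
  have hle : ∫⁻ p : K × K, (-ENNReal.log ‖(p.1 - p.2 : ℂ)‖ₑ).toENNReal
      ∂((μ : Measure K).prod μ) ≤ ENNReal.ofReal M := by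
    calc _ ≤ ∫⁻ p : K × K, liminf (fun n => ENNReal.ofReal (subtypeKernel K R (ε n) p)) atTop
          ∂((μ : Measure K).prod μ) := by
          refine lintegral_mono fun p => ?_
          obtain ⟨a, ha, hle⟩ := tendsto_ofReal_logKernel hR hε0 tendsto_one_div_add_atTop_nhds_zero_nat
            (p.1 - p.2 : ℂ)
          exact hle.trans_eq ha.liminf_eq.symm
      _ ≤ liminf (fun n => ∫⁻ p : K × K, ENNReal.ofReal (subtypeKernel K R (ε n) p)
          ∂((μ : Measure K).prod μ)) atTop := lintegral_liminf_le hmeas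
      _ ≤ liminf (fun _ : ℕ => ENNReal.ofReal M) atTop := by
          refine liminf_le_liminf (Eventually.of_forall fun n => ?_)
          rw [← ofReal_integral_eq_lintegral_ofReal
            (integrable_of_continuous _ (continuous_subtypeKernel K R (hε0 n)))
            (Eventually.of_forall fun p => logKernel_nonneg hR (hε0 n) (hε1 n) (hnorm p))]
          exact ENNReal.ofReal_le_ofReal (hμn n)
      _ = ENNReal.ofReal M := liminf_const _
  rw [lintegral_prod _ hmeasl.aemeasurable] at hle
  rw [hν, hval.lintegral_map] at htop
  simp only [hval.lintegral_map] at htop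
  rw [htop] at hle
  exact ENNReal.ofReal_ne_top (top_le_iff.1 hle)

lemma lintegral_lintegral_sq {X Y : Type*} [MeasurableSpace X] [MeasurableSpace Y] (ν : Measure Y)
    [SFinite ν] (μ : Measure X) [SFinite μ] {G : Y → X → ℝ≥0∞}
    (hG : Measurable fun q : Y × X => G q.1 q.2) :
    ∫⁻ z, (∫⁻ x, G z x ∂μ) ^ 2 ∂ν = ∫⁻ p : X × X, (∫⁻ z, G z p.1 * G z p.2 ∂ν) ∂(μ.prod μ) := by
  have hz : ∀ z, Measurable (G z) := fun z =>
    hG.comp (f := fun x : X => (z, x)) measurable_prodMk_left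
  have h1 : Measurable fun q : Y × X × X => G q.1 q.2.1 :=
    hG.comp (f := fun q : Y × X × X => (q.1, q.2.1)) (by fun_prop)
  have h2 : Measurable fun q : Y × X × X => G q.1 q.2.2 :=
    hG.comp (f := fun q : Y × X × X => (q.1, q.2.2)) (by fun_prop)
  rw [← lintegral_lintegral_swap (f := fun z (p : X × X) => G z p.1 * G z p.2)
    (h1.mul h2).aemeasurable]
  refine lintegral_congr fun z => ?_
  rw [lintegral_prod_mul (hz z).aemeasurable (hz z).aemeasurable, sq]

/-- Smooth functions which are large on a compact polar set and have a controlled Dirichlet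
integral. -/
lemma exists_potential {E K : Set ℂ} (hE : IsPolar E) (hK : IsCompact K) (hKE : K ⊆ E)
    (hne : K.Nonempty) {R : ℝ} (hR : 1 ≤ R) (hKR : K ⊆ ball 0 R) (M : ℝ) :
    ∃ (V : ℝ) (U : ℂ → ℝ), M < V ∧ ContDiff ℝ ∞ U ∧ (∀ x ∈ K, V ≤ U x) ∧
      (∀ z ∈ ball (0 : ℂ) R, z ∉ K → U z ≤ Real.log (4 * R) - Real.log (infDist z K)) ∧
      ∫⁻ z in ball (0 : ℂ) R, ‖fderiv ℝ U z‖ₑ ^ 2 ≤ ENNReal.ofReal (4 * Real.pi * (1 + V)) := by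
  have : CompactSpace K := isCompact_iff_compactSpace.1 hK
  have : Nonempty K := hne.to_subtype
  obtain ⟨ε, hε0, hε1, hε⟩ := exists_forall_lt_kernelEnergy hE hK hKE hR
    (hKR.trans ball_subset_closedBall) M
  obtain ⟨μ, -, hμ⟩ := exists_equilibrium (continuous_subtypeKernel K R hε0) fun x y => by
    rw [subtypeKernel, subtypeKernel, ← logKernel_neg, neg_sub]
  have hR0 : 0 < R := by linarith
  set V := kernelEnergy (subtypeKernel K R ε) (μ : Measure K) with hV
  -- The cutoff makes the kernel compactly supported, as smoothness of the convolution requires. It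
  -- is invisible on the ball of radius `R`, where all differences with points of `K` have norm
  -- below `2 * R`.
  let χ : ContDiffBump (0 : ℂ) := ⟨2 * R, 3 * R, by linarith, by linarith⟩
  set k : ℂ → ℝ := fun z => χ z * logKernel R ε z with hk
  have hkc : ContDiff ℝ ∞ k := χ.contDiff.mul (contDiff_logKernel R hε0)
  have hkd : Differentiable ℝ k := hkc.differentiable (by simp)
  have hkfd : Continuous (fderiv ℝ k) := hkc.continuous_fderiv (by simp)
  have hks : HasCompactSupport k := χ.hasCompactSupport.mul_right
  have hke : ∀ z ∈ ball (0 : ℂ) (2 * R), k z = logKernel R ε z := fun z hz => by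
    rw [hk]; simp only; rw [χ.one_of_mem_closedBall (ball_subset_closedBall hz), one_mul]
  have hmem : ∀ z ∈ ball (0 : ℂ) R, ∀ x : K, z - x ∈ ball (0 : ℂ) (2 * R) := fun z hz x => by
    have h1 := mem_ball_zero_iff.1 (hKR x.2)
    rw [mem_ball_zero_iff] at hz ⊢
    exact (norm_sub_le _ _).trans_lt (by linarith)
  set U : ℂ → ℝ := fun z => ∫ x : K, k (z - x) ∂(μ : Measure K) with hU
  have hUe : ∀ z ∈ ball (0 : ℂ) R, U z = ∫ x : K, logKernel R ε (z - x) ∂(μ : Measure K) :=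
    fun z hz => integral_congr_ae (Eventually.of_forall fun x => hke _ (hmem z hz x))
  have hval : MeasurableEmbedding (Subtype.val : K → ℂ) :=
    MeasurableEmbedding.subtype_coe hK.isClosed.measurableSet
  have hUc : ContDiff ℝ ∞ U := by
    set ν : Measure ℂ := Measure.map (Subtype.val : K → ℂ) (μ : Measure K) with hν
    have hνp : IsProbabilityMeasure ν := Measure.isProbabilityMeasure_map (by fun_prop)
    have h1 : ContDiff ℝ ∞ (convolution (fun _ : ℂ => (1 : ℝ)) k (ContinuousLinearMap.mul ℝ ℝ) ν) :=
      hks.contDiff_convolution_right (n := ⊤) _ (locallyIntegrable_const 1) hkc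
    convert h1 using 1
    ext z
    simp [convolution_def, hν, hval.integral_map, hU]
  have hfd : ∀ z ∈ ball (0 : ℂ) R, ‖fderiv ℝ U z‖ₑ
      ≤ ∫⁻ x : K, ENNReal.ofReal (1 / √(‖z - x‖ ^ 2 + ε ^ 2)) ∂(μ : Measure K) := by
    intro z hz
    obtain ⟨B, hB⟩ := (hks.fderiv ℝ).exists_bound_of_continuous hkfd
    have hd : HasFDerivAt U (∫ x : K, fderiv ℝ k (z - x) ∂(μ : Measure K)) z := by
      refine hasFDerivAt_integral_of_dominated_of_fderiv_le (bound := fun _ => B)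
        (F' := fun z (x : K) => fderiv ℝ k (z - x)) univ_mem ?_ ?_ ?_ ?_ ?_ ?_
      · exact Eventually.of_forall fun w =>
          (hkc.continuous.comp (by fun_prop)).aestronglyMeasurable
      · exact integrable_of_continuous _ (hkc.continuous.comp (by fun_prop))
      · exact (hkfd.comp (by fun_prop)).aestronglyMeasurable
      · exact Eventually.of_forall fun x w _ => hB _
      · exact integrable_const B
      · refine Eventually.of_forall fun x w _ => ?_
        simpa using! (hkd (w - x)).hasFDerivAt.comp w ((hasFDerivAt_id w).sub_const (x : ℂ))
    rw [hd.fderiv]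
    refine (enorm_integral_le_lintegral_enorm _).trans (lintegral_mono fun x => ?_)
    have he : k =ᶠ[𝓝 (z - x)] logKernel R ε := by
      filter_upwards [isOpen_ball.mem_nhds (hmem z hz x)] with w hw using hke w hw
    rw [he.fderiv_eq, ← ofReal_norm]
    exact ENNReal.ofReal_le_ofReal (norm_fderiv_logKernel_le R hε0 _)
  refine ⟨V, U, hε μ, hUc, fun x hx => ?_, fun z hz hzK => ?_, ?_⟩
  · rw [hUe x (hKR hx)]
    exact hμ ⟨x, hx⟩
  · rw [hUe z hz]
    have hd : 0 < infDist z K := (hK.isClosed.notMem_iff_infDist_pos hne).1 hzK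
    have hi : Integrable (fun x : K => logKernel R ε (z - x)) (μ : Measure K) :=
      integrable_of_continuous _ ((contDiff_logKernel R hε0).continuous.comp (by fun_prop))
    calc _ ≤ ∫ x : K, (Real.log (4 * R) - Real.log (infDist z K)) ∂(μ : Measure K) := by
          refine integral_mono hi (integrable_const _) fun x => logKernel_le hd ?_
          rw [← dist_eq_norm]
          exact infDist_le_dist_of_mem x.2
      _ = _ := by simp
  · set G : ℂ → K → ℝ≥0∞ := fun z x => ENNReal.ofReal (1 / √(‖z - x‖ ^ 2 + ε ^ 2)) with hG
    have hGm : Measurable fun q : ℂ × K => G q.1 q.2 := by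
      have hc : Continuous fun q : ℂ × K => √(‖q.1 - q.2‖ ^ 2 + ε ^ 2) := by fun_prop
      exact (measurable_const.div hc.measurable).ennreal_ofReal
    -- The square of the gradient bound is a double integral over `K × K`; exchanging integrals
    -- leaves mutual Dirichlet energies, which are bounded by the kernel and so integrate to the
    -- energy `V`.
    calc ∫⁻ z in ball (0 : ℂ) R, ‖fderiv ℝ U z‖ₑ ^ 2
        ≤ ∫⁻ z in ball (0 : ℂ) R, (∫⁻ x, G z x ∂(μ : Measure K)) ^ 2 := by
          refine setLIntegral_mono' measurableSet_ball fun z hz => ?_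
          gcongr
          exact hfd z hz
      _ = ∫⁻ p : K × K, (∫⁻ z in ball (0 : ℂ) R, G z p.1 * G z p.2)
            ∂((μ : Measure K).prod μ) := lintegral_lintegral_sq _ _ hGm
      _ ≤ ∫⁻ p : K × K, ENNReal.ofReal (4 * Real.pi * (1 + subtypeKernel K R ε p))
            ∂((μ : Measure K).prod μ) := by
          refine lintegral_mono fun p => ?_
          exact lintegral_ball_kernel_mul_le hR hε0 hε1 (mem_ball_zero_iff.1 (hKR p.1.2)).le
            (mem_ball_zero_iff.1 (hKR p.2.2)).le
      _ = ENNReal.ofReal (4 * Real.pi * (1 + V)) := by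
          have hci : Integrable (subtypeKernel K R ε) ((μ : Measure K).prod μ) :=
            integrable_of_continuous _ (continuous_subtypeKernel K R hε0)
          rw [← ofReal_integral_eq_lintegral_ofReal]
          · rw [integral_const_mul, integral_add (integrable_const _) hci]
            simp [hV, kernelEnergy]
          · exact ((integrable_const _).add hci).const_mul _
          · refine Eventually.of_forall fun p => ?_
            have h1 := logKernel_nonneg hR hε0 hε1 (z := (p.1 - p.2 : ℂ))
              (mem_ball_zero_iff.1 (hmem p.1 (hKR p.1.2) p.2)).le
            have := Real.pi_pos
            change 0 ≤ 4 * Real.pi * (1 + logKernel R ε (p.1 - p.2))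
            positivity

end DbarPlane

/-! ### Cutoff functions of small Dirichlet integral -/

namespace DbarPlane

open Complex Set Metric Filter Topology ComplexConjugate

lemma exists_bound_deriv_smoothTransition :
    ∃ B : ℝ, 0 < B ∧ ∀ x, ‖deriv Real.smoothTransition x‖ ≤ B := by
  have hc : Continuous (deriv Real.smoothTransition) :=
    (Real.smoothTransition.contDiff (n := 1)).continuous_deriv le_rfl
  have hs : HasCompactSupport (deriv Real.smoothTransition) := by
    refine HasCompactSupport.of_support_subset_isCompact (isCompact_Icc (a := (0 : ℝ)) (b := 1)) ?_
    intro x hx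
    by_contra h
    rw [mem_Icc, not_and_or, not_le, not_le] at h
    refine hx ?_
    rcases h with h | h
    · have : Real.smoothTransition =ᶠ[𝓝 x] fun _ => 0 := by
        filter_upwards [Iio_mem_nhds h] with y hy
          using Real.smoothTransition.zero_of_nonpos (le_of_lt hy)
      rw [this.deriv_eq]; simp
    · have : Real.smoothTransition =ᶠ[𝓝 x] fun _ => 1 := by
        filter_upwards [Ioi_mem_nhds h] with y hy
          using Real.smoothTransition.one_of_one_le (le_of_lt hy)
      rw [this.deriv_eq]; simp
  obtain ⟨B, hB⟩ := hs.exists_bound_of_continuous hc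
  exact ⟨max B 1, by positivity, fun x => (hB x).trans (le_max_left _ _)⟩

/-- Compact polar sets have zero Dirichlet capacity: they admit smooth cutoff functions with
Dirichlet integral tending to zero. -/
lemma exists_cutoffs {E K : Set ℂ} (hE : IsPolar E) (hK : IsCompact K) (hKE : K ⊆ E)
    {R : ℝ} (hR : 1 ≤ R) (hKR : K ⊆ ball 0 R) :
    ∃ ψ : ℕ → ℂ → ℝ, (∀ n, ContDiff ℝ ∞ (ψ n)) ∧ (∀ n z, 0 ≤ ψ n z ∧ ψ n z ≤ 1) ∧
      (∀ n, ∀ x ∈ K, ∀ᶠ z in 𝓝 x, ψ n z = 1) ∧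
      (∀ z ∈ ball (0 : ℂ) R, z ∉ K → Tendsto (fun n => ψ n z) atTop (𝓝 0)) ∧
      Tendsto (fun n => ∫⁻ z in ball (0 : ℂ) R, ‖fderiv ℝ (ψ n) z‖ₑ ^ 2) atTop (𝓝 0) := by
  rcases K.eq_empty_or_nonempty with rfl | hne
  · exact ⟨fun _ _ => 0, fun _ => contDiff_const, by simp, by simp, by simp, by
      simp [enorm_eq_nnnorm]⟩
  obtain ⟨B, hB0, hB⟩ := exists_bound_deriv_smoothTransition
  choose V U hV hUc hUK hUle hUint using fun n : ℕ =>
    exists_potential hE hK hKE hne hR hKR ((n : ℝ) + 1)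
  have hV1 : ∀ n, 1 < V n := fun n => by have := hV n; have := n.cast_nonneg (α := ℝ); linarith
  have hV0 : ∀ n, 0 < V n := fun n => one_pos.trans (hV1 n)
  -- The transition is `1` where `U n ≥ 2 V / 3`, a neighbourhood of `K`, and `0` where `U n ≤ V /
  -- 3`, which holds at each point of the ball off `K` once `n` is large. Its slope is at most `3 B
  -- / V` times that of `U n`.
  refine ⟨fun n z => Real.smoothTransition (3 * (V n)⁻¹ * U n z - 1), fun n => ?_, fun n z =>
    ⟨Real.smoothTransition.nonneg _, Real.smoothTransition.le_one _⟩, fun n x hx => ?_,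
    fun z hz hzK => ?_, ?_⟩
  · exact Real.smoothTransition.contDiff.comp ((contDiff_const.mul (hUc n)).sub contDiff_const)
  · have h1 : V n * (2 / 3) < U n x := by
      have := hUK n x hx
      have := hV0 n
      linarith
    filter_upwards [(hUc n).continuous.continuousAt.eventually (lt_mem_nhds h1)] with z hz
    refine Real.smoothTransition.one_of_one_le ?_
    have : 3 * (V n)⁻¹ * (V n * (2 / 3)) = 2 := by
      have := (hV0 n).ne'
      field_simp
    have h3 : 0 < 3 * (V n)⁻¹ := by have := hV0 n; positivity
    nlinarith
  · refine tendsto_const_nhds.congr' ?_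
    filter_upwards [eventually_ge_atTop ⌈3 * (Real.log (4 * R) - Real.log (infDist z K))⌉₊]
      with n hn
    refine (Real.smoothTransition.zero_of_nonpos ?_).symm
    have h1 := hUle n z hz hzK
    have h2 := Nat.le_of_ceil_le hn
    have h3 := hV n
    have h4 : 3 * U n z ≤ V n := by linarith
    have h5 := hV0 n
    have : 3 * (V n)⁻¹ * U n z = 3 * U n z / V n := by ring
    rw [this, sub_nonpos, div_le_one h5]
    exact h4
  · have hfd : ∀ n z, ‖fderiv ℝ (fun z => Real.smoothTransition (3 * (V n)⁻¹ * U n z - 1)) z‖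
        ≤ 3 * B * (V n)⁻¹ * ‖fderiv ℝ (U n) z‖ := by
      intro n z
      have h1 : HasFDerivAt (fun z => 3 * (V n)⁻¹ * U n z - 1)
          ((3 * (V n)⁻¹) • fderiv ℝ (U n) z) z :=
        ((((hUc n).differentiable (by simp)) z).hasFDerivAt.const_mul _).sub_const 1
      have h2 : HasDerivAt Real.smoothTransition (deriv Real.smoothTransition
          (3 * (V n)⁻¹ * U n z - 1)) (3 * (V n)⁻¹ * U n z - 1) :=
        (((Real.smoothTransition.contDiff (n := 1)).differentiable one_ne_zero) _).hasDerivAt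
      have h3 := (h2.comp_hasFDerivAt z h1).fderiv
      have h4 : fderiv ℝ (fun z => Real.smoothTransition (3 * (V n)⁻¹ * U n z - 1)) z = _ := h3
      have h5 := hV0 n
      rw [h4, norm_smul, norm_smul, Real.norm_of_nonneg (r := 3 * (V n)⁻¹) (by positivity)]
      calc _ ≤ B * (3 * (V n)⁻¹ * ‖fderiv ℝ (U n) z‖) := by
            gcongr
            exact hB _
        _ = _ := by ring
    have hle : ∀ n, ∫⁻ z in ball (0 : ℂ) R,
        ‖fderiv ℝ (fun z => Real.smoothTransition (3 * (V n)⁻¹ * U n z - 1)) z‖ₑ ^ 2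
        ≤ ENNReal.ofReal (72 * Real.pi * B ^ 2 * (1 / ((n : ℝ) + 1))) := by
      intro n
      have h5 := hV0 n
      have hpi := Real.pi_pos
      calc _ ≤ ∫⁻ z in ball (0 : ℂ) R,
            ENNReal.ofReal ((3 * B * (V n)⁻¹) ^ 2) * ‖fderiv ℝ (U n) z‖ₑ ^ 2 := by
            refine lintegral_mono fun z => ?_
            rw [ENNReal.ofReal_pow (by positivity), ← mul_pow, ← ofReal_norm, ← ofReal_norm,
              ← ENNReal.ofReal_mul (by positivity)]
            gcongr
            exact hfd n z
        _ = ENNReal.ofReal ((3 * B * (V n)⁻¹) ^ 2) *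
            ∫⁻ z in ball (0 : ℂ) R, ‖fderiv ℝ (U n) z‖ₑ ^ 2 :=
          lintegral_const_mul' _ _ ENNReal.ofReal_ne_top
        _ ≤ ENNReal.ofReal ((3 * B * (V n)⁻¹) ^ 2) * ENNReal.ofReal (4 * Real.pi * (1 + V n)) := by
            gcongr
            exact hUint n
        _ = ENNReal.ofReal ((3 * B * (V n)⁻¹) ^ 2 * (4 * Real.pi * (1 + V n))) :=
          (ENNReal.ofReal_mul (by positivity)).symm
        _ ≤ _ := by
            refine ENNReal.ofReal_le_ofReal ?_
            have h6 : (3 * B * (V n)⁻¹) ^ 2 * (4 * Real.pi * (1 + V n))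
                = 36 * Real.pi * B ^ 2 * ((1 + V n) / V n * (1 / V n)) := by
              field_simp
              ring
            have h7 : (1 + V n) / V n ≤ 2 := by
              rw [div_le_iff₀ h5]; linarith [hV1 n]
            have h8 : 1 / V n ≤ 1 / ((n : ℝ) + 1) :=
              one_div_le_one_div_of_le (by positivity) (hV n).le
            rw [h6]
            calc _ ≤ 36 * Real.pi * B ^ 2 * (2 * (1 / ((n : ℝ) + 1))) := by gcongr
              _ = _ := by ring
    refine tendsto_of_tendsto_of_tendsto_of_le_of_le tendsto_const_nhds ?_ (fun _ => zero_le) hle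
    have := (tendsto_one_div_add_atTop_nhds_zero_nat (𝕜 := ℝ)).const_mul (72 * Real.pi * B ^ 2)
    rw [mul_zero] at this
    exact ENNReal.ofReal_zero ▸ (ENNReal.continuous_ofReal.tendsto 0).comp this

/-! ### Polar sets are null -/

lemma toENNReal_neg_log_le {v : ℂ} (hv : v ≠ 0) :
    (-ENNReal.log ‖v‖ₑ).toENNReal ≤ ENNReal.ofReal Real.pi * ‖(Real.pi * v : ℂ)⁻¹‖ₑ := by
  have hv0 : 0 < ‖v‖ := norm_pos_iff.2 hv
  have hpi := Real.pi_pos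
  rw [← ofReal_norm, ENNReal.log_ofReal_of_pos hv0, ← EReal.coe_neg, EReal.real_coe_toENNReal,
    ← ofReal_norm, ← ENNReal.ofReal_mul hpi.le]
  refine ENNReal.ofReal_le_ofReal ?_
  rw [norm_inv, norm_mul, norm_real, Real.norm_of_nonneg hpi.le, ← Real.log_inv, mul_inv,
    mul_inv_cancel_left₀ hpi.ne']
  have := Real.log_le_sub_one_of_pos (inv_pos.2 hv0)
  linarith

/-- Otherwise Lebesgue measure on `K` would be admissible, yet its energy integral is finite: the
logarithmic singularity is dominated by the locally integrable Cauchy kernel. -/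
lemma IsPolar.volume_eq_zero_of_isCompact {E K : Set ℂ} (hE : IsPolar E) (hK : IsCompact K)
    (hKE : K ⊆ E) : volume K = 0 := by
  by_contra hne
  have hfin : IsFiniteMeasure (volume.restrict K) := ⟨by simpa using hK.measure_lt_top⟩
  have hs : (volume.restrict K).support ⊆ K := Measure.support_subset_of_isClosed hK.isClosed
    (ae_restrict_mem hK.isClosed.measurableSet)
  have htop := hE.lintegral_eq_top (μ := volume.restrict K)
    (by rwa [Ne, Measure.restrict_eq_zero]) (hK.of_isClosed_subset Measure.isClosed_support hs)
    (hs.trans hKE)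
  obtain ⟨R, hR0, hR⟩ := hK.isBounded.exists_pos_norm_lt
  set D := ∫⁻ v in ball (0 : ℂ) (2 * R), ‖(Real.pi * v : ℂ)⁻¹‖ₑ with hD
  have hDt : D ≠ ⊤ := by
    have := (locallyIntegrable_inv_pi_mul.integrableOn_isCompact
      (isCompact_closedBall (0 : ℂ) (2 * R))).mono_set ball_subset_closedBall
    exact this.2.ne
  have hle : ∀ z ∈ K, ∫⁻ w in K, (-ENNReal.log ‖z - w‖ₑ).toENNReal ≤ ENNReal.ofReal Real.pi * D := by
    intro z hz
    have hne : ∀ᵐ w, w ≠ z := by rw [ae_iff]; simp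
    rw [← lintegral_indicator hK.isClosed.measurableSet]
    calc _ ≤ ∫⁻ w, (ball (0 : ℂ) (2 * R)).indicator
          (fun v => ENNReal.ofReal Real.pi * ‖(Real.pi * v : ℂ)⁻¹‖ₑ) (z - w) := by
          refine lintegral_mono_ae ?_
          filter_upwards [hne] with w hw
          by_cases hwK : w ∈ K
          · have : z - w ∈ ball (0 : ℂ) (2 * R) := by
              rw [mem_ball_zero_iff]
              exact (norm_sub_le z w).trans_lt (by linarith [hR z hz, hR w hwK])
            rw [indicator_of_mem hwK, indicator_of_mem this]
            exact toENNReal_neg_log_le (sub_ne_zero.2 hw.symm)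
          · rw [indicator_of_notMem hwK]
            exact zero_le
      _ = ENNReal.ofReal Real.pi * D := by
          rw [lintegral_sub_left_eq_self _ z, lintegral_indicator measurableSet_ball,
            lintegral_const_mul' _ _ ENNReal.ofReal_ne_top]
  have h2 : ∫⁻ z in K, ∫⁻ w in K, (-ENNReal.log ‖z - w‖ₑ).toENNReal
      ≤ ∫⁻ z in K, ENNReal.ofReal Real.pi * D :=
    setLIntegral_mono' hK.isClosed.measurableSet hle
  rw [htop, setLIntegral_const, top_le_iff] at h2
  exact ENNReal.mul_ne_top (ENNReal.mul_ne_top ENNReal.ofReal_ne_top hDt) hK.measure_lt_top.ne h2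

lemma IsPolar.volume_diff_eq_zero {Ω Ω' : Set ℂ} (hΩ : IsOpen Ω) (hΩ' : IsOpen Ω')
    (hE : IsPolar (Ω \ Ω')) : volume (Ω \ Ω') = 0 := by
  refine measure_null_of_locally_null _ fun x hx => ?_
  obtain ⟨r, hr, hb⟩ := nhds_basis_closedBall.mem_iff.1 (hΩ.mem_nhds hx.1)
  refine ⟨closedBall x r \ Ω', ?_, hE.volume_eq_zero_of_isCompact
    ((isCompact_closedBall x r).diff hΩ') (sdiff_subset_sdiff_left hb)⟩
  filter_upwards [self_mem_nhdsWithin, mem_nhdsWithin_of_mem_nhds (closedBall_mem_nhds x hr)]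
    with y hy hyb using ⟨hyb, hy.2⟩

/-! ### Removability of polar sets -/

lemma WeakDbar.mono {Ω Ω' : Set ℂ} {u f : ℂ → ℂ} (h : WeakDbar Ω u f) (hs : Ω' ⊆ Ω) :
    WeakDbar Ω' u f := by
  intro φ hφ
  have h1 := h φ (hφ.mono hs)
  have hts := tsupport_wirtingerBar_subset φ
  rwa [setIntegral_mul_eq_of_tsupport_subset _ (hts.trans (hφ.2.2.trans hs)),
    setIntegral_mul_eq_of_tsupport_subset _ (hφ.2.2.trans hs),
    ← setIntegral_mul_eq_of_tsupport_subset _ (hts.trans hφ.2.2),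
    ← setIntegral_mul_eq_of_tsupport_subset _ hφ.2.2] at h1

lemma tendsto_integral_mul_cutoff {F : ℂ → ℂ} (hF : Integrable F) {ψ : ℕ → ℂ → ℝ}
    (hc : ∀ n, Continuous (ψ n)) (h01 : ∀ n z, 0 ≤ ψ n z ∧ ψ n z ≤ 1)
    (hlim : ∀ᵐ z, F z ≠ 0 → Tendsto (fun n => ψ n z) atTop (𝓝 0)) :
    Tendsto (fun n => ∫ z, F z * (1 - (ψ n z : ℂ))) atTop (𝓝 (∫ z, F z)) := by
  refine tendsto_integral_of_dominated_convergence (fun z => ‖F z‖) (fun n => ?_) hF.norm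
    (fun n => Eventually.of_forall fun z => ?_) ?_
  · have := hc n
    exact hF.aestronglyMeasurable.mul (by fun_prop)
  · rw [norm_mul, ← ofReal_one, ← ofReal_sub, norm_real, Real.norm_of_nonneg (by linarith [h01 n z])]
    exact mul_le_of_le_one_right (norm_nonneg _) (by linarith [h01 n z])
  · filter_upwards [hlim] with z hz
    by_cases h0 : F z = 0
    · simp [h0]
    · have h1 : Tendsto (fun n => (ψ n z : ℂ)) atTop (𝓝 0) :=
        (continuous_ofReal.tendsto' 0 0 ofReal_zero).comp (hz h0)
      simpa using (h1.const_sub 1).const_mul (F z)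

/-- Polar sets are removable for the weak `∂̄`-equation for functions in `L²`. -/
lemma WeakDbar.of_diff_polar {Ω Ω' : Set ℂ} (hΩ' : IsOpen Ω') (hE : IsPolar (Ω \ Ω'))
    {u f : ℂ → ℂ} (hu : MemLp u 2 (volume.restrict Ω))
    (hul : LocallyIntegrableOn u Ω) (hfl : LocallyIntegrableOn f Ω)
    (h : WeakDbar Ω' u f) : WeakDbar Ω u f := by
  intro φ hφ
  have hφ1 := hφ.contDiff_one
  obtain ⟨R, hR1, hR⟩ : ∃ R : ℝ, 1 ≤ R ∧ tsupport φ ⊆ ball 0 R := by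
    obtain ⟨R, hR0, hR⟩ := hφ.2.1.isCompact.isBounded.exists_pos_norm_lt
    exact ⟨max R 1, le_max_right _ _, fun z hz =>
      mem_ball_zero_iff.2 ((hR z hz).trans_le (le_max_left _ _))⟩
  set K := tsupport φ \ Ω' with hKdef
  have hK : IsCompact K := hφ.2.1.isCompact.diff hΩ'
  have hKE : K ⊆ Ω \ Ω' := sdiff_subset_sdiff_left hφ.2.2
  have hK0 : volume K = 0 := hE.volume_eq_zero_of_isCompact hK hKE
  obtain ⟨ψ, hψc, hψ01, hψ1, hψlim, hψint⟩ :=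
    exists_cutoffs hE hK hKE hR1 (sdiff_subset.trans hR)
  have hwts := tsupport_wirtingerBar_subset φ
  have hwc := continuous_wirtingerBar hφ1
  set X : ℕ → ℂ → ℂ := fun n z => 1 - (ψ n z : ℂ) with hX
  have hXc : ∀ n, ContDiff ℝ ∞ (X n) := fun n =>
    contDiff_const.sub (ofRealCLM.contDiff.comp (hψc n))
  have hX1 : ∀ n, ContDiff ℝ 1 (X n) := fun n => (hXc n).of_le (by exact_mod_cast le_top)
  have hXfd : ∀ n z, ‖wirtingerBar (X n) z‖ ≤ ‖fderiv ℝ (ψ n) z‖ := by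
    intro n z
    have h1 := ((ofRealCLM.hasFDerivAt (x := ψ n z)).comp z
      (((hψc n).differentiable (by simp)) z).hasFDerivAt).const_sub (1 : ℂ)
    have h2 : fderiv ℝ (X n) z = _ := h1.fderiv
    refine (norm_wirtingerBar_le _ _).trans ?_
    rw [h2, norm_neg]
    refine (ContinuousLinearMap.opNorm_comp_le _ _).trans ?_
    rw [ofRealCLM_norm, one_mul]
  -- The factor `X n` vanishes near `K`, the only part of the support of `φ` outside `Ω'`.
  have htest : ∀ n, IsTestFunction Ω' fun z => X n z * φ z := by
    intro n
    have hts : tsupport (fun z => X n z * φ z) ⊆ tsupport φ :=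
      closure_mono fun z hz => right_ne_zero_of_mul hz
    refine ⟨(hXc n).mul hφ.1, hφ.2.1.of_isClosed_subset (isClosed_tsupport _) hts, fun x hx => ?_⟩
    by_contra hxΩ
    rw [tsupport, mem_closure_iff_frequently] at hx
    refine hx ?_
    filter_upwards [hψ1 n x ⟨hts (by rwa [tsupport, mem_closure_iff_frequently]), hxΩ⟩] with z hz
    simp [hX, hz]
  have hi1 : Integrable fun z => u z * wirtingerBar φ z :=
    integrable_mul_of_tsupport_subset hul hwc (hasCompactSupport_wirtingerBar hφ.2.1)
      (hwts.trans hφ.2.2)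
  have hi2 : Integrable fun z => f z * φ z :=
    integrable_mul_of_tsupport_subset hfl hφ1.continuous hφ.2.1 hφ.2.2
  have hts3 : ∀ n, tsupport (fun z => wirtingerBar (X n) z * φ z) ⊆ tsupport φ := fun n =>
    closure_mono fun z hz => right_ne_zero_of_mul hz
  have hi3 : ∀ n, Integrable fun z => u z * (wirtingerBar (X n) z * φ z) := fun n =>
    integrable_mul_of_tsupport_subset hul
      ((continuous_wirtingerBar (hX1 n)).mul hφ1.continuous)
      (hφ.2.1.of_isClosed_subset (isClosed_tsupport _) (hts3 n)) ((hts3 n).trans hφ.2.2)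
  have hi4 : ∀ n, Integrable fun z => u z * wirtingerBar φ z * X n z := fun n => by
    have hts : tsupport (fun z => wirtingerBar φ z * X n z) ⊆ tsupport φ :=
      (closure_mono fun z hz => left_ne_zero_of_mul hz).trans hwts
    simp only [mul_assoc]
    exact integrable_mul_of_tsupport_subset hul (hwc.mul (hXc n).continuous)
      (hφ.2.1.of_isClosed_subset (isClosed_tsupport _) hts) (hts.trans hφ.2.2)
  have hid : ∀ n, ∫ z, u z * wirtingerBar φ z * X n z
      = -(∫ z, f z * φ z * X n z) - ∫ z, u z * (wirtingerBar (X n) z * φ z) := by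
    intro n
    have h1 := h _ (htest n)
    rw [setIntegral_mul_eq_of_tsupport_subset _
      ((tsupport_wirtingerBar_subset _).trans (htest n).2.2),
      setIntegral_mul_eq_of_tsupport_subset _ (htest n).2.2] at h1
    have h2 : ∀ z, u z * wirtingerBar (fun z => X n z * φ z) z
        = u z * wirtingerBar φ z * X n z + u z * (wirtingerBar (X n) z * φ z) := fun z => by
      rw [wirtingerBar_mul ((hX1 n).differentiable one_ne_zero z) (hφ.differentiable z)]
      ring
    have h3 : ∀ z, f z * (X n z * φ z) = f z * φ z * X n z := fun z => by ring
    simp only [h2, h3] at h1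
    rw [integral_add (hi4 n) (hi3 n)] at h1
    linear_combination h1
  have hlim : ∀ᵐ z, z ∈ tsupport φ → Tendsto (fun n => ψ n z) atTop (𝓝 0) := by
    filter_upwards [measure_eq_zero_iff_ae_notMem.1 hK0] with z hz hzφ using hψlim z (hR hzφ) hz
  have hl1 := tendsto_integral_mul_cutoff hi1 (fun n => (hψc n).continuous) hψ01
    (by filter_upwards [hlim] with z hz h0 using
      hz (hwts (subset_tsupport _ (right_ne_zero_of_mul h0))))
  have hl2 := tendsto_integral_mul_cutoff hi2 (fun n => (hψc n).continuous) hψ01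
    (by filter_upwards [hlim] with z hz h0 using
      hz (subset_tsupport _ (right_ne_zero_of_mul h0)))
  -- Cauchy–Schwarz: `u` is in `L²`, `φ` is bounded, and the gradients of `ψ n` tend to zero in `L²`
  -- on a ball containing the support of `φ`.
  have hl3 : Tendsto (fun n => ∫ z, u z * (wirtingerBar (X n) z * φ z)) atTop (𝓝 0) := by
    obtain ⟨C, hC⟩ := hφ.2.1.exists_bound_of_continuous hφ1.continuous
    have hC0 : 0 ≤ C := (norm_nonneg _).trans (hC 0)
    set A := (∫⁻ z in Ω, ‖u z‖ₑ ^ (2 : ℝ)) ^ (1 / 2 : ℝ) with hA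
    have hAt : A ≠ ⊤ := by
      have := (lintegral_rpow_enorm_lt_top_of_eLpNorm_lt_top (by simp) (by simp) hu.2).ne
      simp only [ENNReal.toReal_ofNat] at this
      exact ENNReal.rpow_ne_top_of_nonneg (by norm_num) this
    have hle : ∀ n, ‖∫ z, u z * (wirtingerBar (X n) z * φ z)‖ₑ
        ≤ A * (ENNReal.ofReal (C ^ 2) * ∫⁻ z in ball (0 : ℂ) R, ‖fderiv ℝ (ψ n) z‖ₑ ^ 2)
          ^ (1 / 2 : ℝ) := by
      intro n
      rw [← setIntegral_mul_eq_of_tsupport_subset u ((hts3 n).trans hφ.2.2)]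
      refine (enorm_integral_le_lintegral_enorm _).trans ?_
      simp only [enorm_mul (u _)]
      refine (ENNReal.lintegral_mul_le_Lp_mul_Lq (volume.restrict Ω) Real.HolderConjugate.two_two
        hu.1.enorm (Continuous.aemeasurable ?_)).trans ?_
      · exact (((continuous_wirtingerBar (hX1 n)).mul hφ1.continuous)).enorm
      · rw [hA]
        gcongr
        rw [← lintegral_const_mul' _ _ ENNReal.ofReal_ne_top,
          ← lintegral_indicator measurableSet_ball]
        refine (lintegral_mono fun z => ?_).trans (setLIntegral_le_lintegral Ω _)
        by_cases hz : z ∈ ball (0 : ℂ) R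
        · rw [indicator_of_mem hz, ENNReal.rpow_two, ENNReal.ofReal_pow hC0, ← mul_pow,
            ← ofReal_norm, ← ofReal_norm, ← ENNReal.ofReal_mul hC0, norm_mul, mul_comm]
          gcongr
          · exact hC z
          · exact hXfd n z
        · have : φ z = 0 := image_eq_zero_of_notMem_tsupport fun h => hz (hR h)
          simp [this]
    rw [tendsto_zero_iff_enorm_tendsto_zero]
    refine tendsto_of_tendsto_of_tendsto_of_le_of_le tendsto_const_nhds ?_ (fun _ => zero_le) hle
    have h1 := ENNReal.Tendsto.const_mul (a := ENNReal.ofReal (C ^ 2)) hψint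
      (Or.inr ENNReal.ofReal_ne_top)
    rw [mul_zero] at h1
    have h2 := ENNReal.Tendsto.const_mul (a := A)
      ((ENNReal.continuous_rpow_const (y := 1 / 2)).tendsto 0 |>.comp h1) (Or.inr hAt)
    simpa using h2
  rw [setIntegral_mul_eq_of_tsupport_subset _ (hwts.trans hφ.2.2),
    setIntegral_mul_eq_of_tsupport_subset _ hφ.2.2]
  have h5 := hl2.neg.sub hl3
  rw [sub_zero] at h5
  exact tendsto_nhds_unique hl1 (h5.congr fun n => (hid n).symm)

/-! ### Invariance under removal of a polar set -/

lemma locallyIntegrableOn_of_memLp {Ω : Set ℂ} {u : ℂ → ℂ} (hu : MemLp u 2 (volume.restrict Ω)) :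
    LocallyIntegrableOn u Ω :=
  locallyIntegrableOn_of_locallyIntegrable_restrict (hu.locallyIntegrable (by norm_num))

theorem closedRangeConst_eq_of_diff_polar {Ω Ω' : Set ℂ} (hΩ : IsOpen Ω) (hΩ' : IsOpen Ω')
    (hs : Ω' ⊆ Ω) (hE : IsPolar (Ω \ Ω')) : closedRangeConst Ω' = closedRangeConst Ω := by
  have hres : volume.restrict Ω' = volume.restrict Ω := by
    refine Measure.restrict_congr_set ?_
    rw [ae_eq_set]
    exact ⟨by simp [sdiff_eq_empty.2 hs], hE.volume_diff_eq_zero hΩ hΩ'⟩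
  have hiff : ∀ C, HasClosedRangeWith Ω' C ↔ HasClosedRangeWith Ω C := by
    intro C
    rw [hasClosedRangeWith_iff, hasClosedRangeWith_iff, hres]
    refine ⟨fun h u f hu hf hd ho => h u f hu hf (hd.mono hs) fun g hg hgm => ?_,
      fun h u f hu hf hd ho => h u f hu hf (hd.of_diff_polar hΩ' hE hu
        (locallyIntegrableOn_of_memLp hu) (locallyIntegrableOn_of_memLp hf))
        fun g hg hgm => ho g (hg.mono hs) hgm⟩
    have hgl := locallyIntegrableOn_of_memLp hgm
    -- Orthogonality on `Ω` must be tested against `g` holomorphic only on `Ω'`: it solves the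
    -- homogeneous equation across the polar set, so by Weyl's lemma it agrees almost everywhere
    -- with some `k` holomorphic on `Ω`.
    have hw : WeakDbar Ω g 0 := (weakDbar_zero_of_differentiableOn hΩ' hg).of_diff_polar hΩ' hE hgm
      hgl (locallyIntegrableOn_of_memLp MemLp.zero)
    obtain ⟨k, hk, hgk⟩ := exists_holomorphic_of_weakDbar_zero hΩ hgl hw
    rw [← ho k hk ((memLp_congr_ae hgk).1 hgm)]
    refine integral_congr_ae ?_
    filter_upwards [hgk] with z hz
    rw [hz]
  simp only [closedRangeConst, hiff]

end DbarPlane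

theorem proposition2p4 (Ω : Set ℂ) (hΩ : IsOpen Ω) :
    (∀ T : ℂ ≃ᵢ ℂ, DbarPlane.closedRangeConst (T '' Ω) = DbarPlane.closedRangeConst Ω) ∧
    (∀ r : ℝ, 0 < r →
      DbarPlane.closedRangeConst ((fun z : ℂ => (r : ℂ) * z) '' Ω) =
        ENNReal.ofReal r * DbarPlane.closedRangeConst Ω) ∧
    (∀ Ω' : Set ℂ, IsOpen Ω' → Ω' ⊆ Ω → DbarPlane.IsPolar (Ω \ Ω') →
      DbarPlane.closedRangeConst Ω' = DbarPlane.closedRangeConst Ω) :=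
  ⟨fun T => DbarPlane.closedRangeConst_isometry T hΩ,
    fun _ hr => DbarPlane.closedRangeConst_real_mul hr Ω,
    fun _ hΩ' hs hE => DbarPlane.closedRangeConst_eq_of_diff_polar hΩ hΩ' hs hE⟩
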